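/- Let $(\Omega,\mathcal F,\mathbb P)$ be a probability space and let $Z=(Z_H(t))_{(t,H)\in[0,\infty)\times(0,1)}$ be a fractional Gaussian field on it, i.e. a centered, jointly Gaussian family of real random variables with $$\mathbb E[Z_H(t)Z_{H'}(s)]=\tfrac{a_{H,H'}}{2}\left(|t|^{H+H'}+|s|^{H+H'}-|t-s|^{H+H'}\right)$$ for all $s,t\ge 0$ and $H,H'\in(0,1)$, where, for $H+H'\neq 1$, $$a_{H,H'}=-\tfrac{2}{\pi}\sqrt{\Gamma(2H+1)\sin(\pi H)}\,\sqrt{\Gamma(2H'+1)\sin(\pi H')}\;\Gamma(-(H+H'))\cos\left((H'-H)\tfrac{\pi}{2}\right)\cos\left((H+H')\tfrac{\pi}{2}\right),$$ and, for $H+H'=1$, $a_{H,H'}=a_H:=\sqrt{\Gamma(2H+1)\Gamma(3-2H)}\,\sin^2(\pi H)$. Let $H\in(0,1)$, let $\mathcal F^H_t=\sigma(Z_H(r):0\le r\le t)$ and define $M_H(t)=\mathbb E[Z_{1-H}(t)\mid\mathcal F^H_t]$ for $t\ge 0$. Then the process $(M_H(t))_{t\ge 0}$ is a martingale with respect to $(\mathcal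 F^H_t)_{t\ge 0}$ and has independent increments, and for all $s,t\ge 0$ the product $M_H(t)M_H(s)$ is integrable with $$\mathbb E[M_H(t)M_H(s)]=c_M\,(s\wedge t)^{2-2H},\qquad c_M=\frac{a_H^2\,\Gamma(3/2-H)}{2H\,\Gamma(H+1/2)\,\Gamma(3-2H)}.$$ -/

import Mathlib

open MeasureTheory ProbabilityTheory
open scoped NNReal

namespace DobricOjeda

/-- The Hurst index `H' = 1 - H` conjugate to `H`. -/
def conjIndex (H : Set.Ioo (0 : ℝ) 1) : Set.Ioo (0 : ℝ) 1 :=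
  ⟨1 - (H : ℝ), by have h0 := H.2.1; have h1 := H.2.2; constructor <;> linarith⟩

/-- `a_H = √(Γ(2H+1) Γ(3-2H)) sin²(π H)`. -/
noncomputable def conjCoeff (H : ℝ) : ℝ :=
  Real.sqrt (Real.Gamma (2 * H + 1) * Real.Gamma (3 - 2 * H)) * Real.sin (Real.pi * H) ^ 2

open Classical in
/-- The coefficient `a_{H,H'}` of the covariance of the fractional Gaussian field. -/
noncomputable def fieldCoeff (H H' : ℝ) : ℝ :=
  if H + H' = 1 then conjCoeff H
  else
    -(2 / Real.pi) * Real.sqrt (Real.Gamma (2 * H + 1) * Real.sin (Real.pi * H))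
      * Real.sqrt (Real.Gamma (2 * H' + 1) * Real.sin (Real.pi * H'))
      * Real.Gamma (-(H + H')) * Real.cos ((H' - H) * (Real.pi / 2))
      * Real.cos ((H + H') * (Real.pi / 2))

/-- `Z = (Z_H(t))`, indexed by `(t, H) ∈ [0,∞) × (0,1)`, is a fractional Gaussian field: a centered
Gaussian random field with
`E[Z_H(t) Z_{H'}(s)] = (a_{H,H'} / 2) (|t|^(H+H') + |s|^(H+H') - |t-s|^(H+H'))`. -/
structure IsFractionalGaussianField {Ω : Type*} [MeasurableSpace Ω]
    (Z : ℝ≥0 × Set.Ioo (0 : ℝ) 1 → Ω → ℝ) (P : Measure Ω) : Prop where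
  measurable : ∀ p, Measurable (Z p)
  gaussian : IsGaussianProcess Z P
  centered : ∀ p, ∫ ω, Z p ω ∂P = 0
  covariance : ∀ (t s : ℝ≥0) (H H' : Set.Ioo (0 : ℝ) 1),
    ∫ ω, Z (t, H) ω * Z (s, H') ω ∂P =
      fieldCoeff H H' / 2 *
        (|(t : ℝ)| ^ ((H : ℝ) + H') + |(s : ℝ)| ^ ((H : ℝ) + H')
          - |(t : ℝ) - s| ^ ((H : ℝ) + H'))

/-- The filtration `ℱ_t^H = σ(Z_H(r) : 0 ≤ r ≤ t)`. -/
def history {Ω : Type*} [mΩ : MeasurableSpace Ω]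
    (Z : ℝ≥0 × Set.Ioo (0 : ℝ) 1 → Ω → ℝ) (hZ : ∀ p, Measurable (Z p))
    (H : Set.Ioo (0 : ℝ) 1) : Filtration ℝ≥0 mΩ :=
  Filtration.natural (fun t => Z (t, H)) (fun t => (hZ (t, H)).stronglyMeasurable)

/-- The process `M_H(t) = E[Z_{H'}(t) | ℱ_t^H]`, where `H + H' = 1`. -/
noncomputable def processM {Ω : Type*} [MeasurableSpace Ω]
    (Z : ℝ≥0 × Set.Ioo (0 : ℝ) 1 → Ω → ℝ) (hZ : ∀ p, Measurable (Z p)) (P : Measure Ω)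
    (H : Set.Ioo (0 : ℝ) 1) (t : ℝ≥0) : Ω → ℝ :=
  P[Z (t, conjIndex H) | history Z hZ H t]

/-- The constant `c_M = a_H² Γ(3/2-H) / (2H Γ(H+1/2) Γ(3-2H))`. -/
noncomputable def constM (H : ℝ) : ℝ :=
  conjCoeff H ^ 2 * Real.Gamma (3 / 2 - H) /
    (2 * H * Real.Gamma (H + 1 / 2) * Real.Gamma (3 - 2 * H))

end DobricOjeda

/-! In the Gaussian Hilbert space, conditioning on `ℱ_t^H` is orthogonal projection onto the closed
span of `Z_H(r)`, `r ≤ t`. Since `H + (1 - H) = 1`, the cross covariance is linear: `E[Z_{1-H}(t)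
Z_H(r)] = a_H r` for `r ≤ t`, whatever `t` is. So `M_H(t)` is the element of that span whose scalar
product with each `Z_H(r)` is `a_H r`.

This element is a multiple of `∫₀ᵗ u^α (t-u)^α dZ_H(u)` with `α = 1/2 - H`. After rescaling to `t =
1`, this amounts to `integral_kernel_mul_signedPower`: integrating the kernel against `sgn(u-r)
|u-r|^(-2α)` gives an affine function of `r`. With `L` the part of the integral over `u < r`, up to
sign, the whole integral is `L(1-r) - L(r)`. A power series computation shows that `L''` is a
multiple of `(r(1-r))^(-α-1)`, which is invariant under `r ↦ 1-r`, so the difference has zero second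
derivative. `exists_projection` assembles the projection and reads off the constant from Beta
integrals.

On the probabilistic side, `L²` limits stay jointly Gaussian, so orthogonality to the past means
independence of it (`condExp_eq_zero_of_orthogonal`). As `a_H r` does not involve `t`, the
increments of `Z_{1-H}` after `s` are orthogonal to the past of `Z_H` up to `s`; this gives the
martingale property and a covariance depending only on `s ∧ t`. Increments are then uncorrelated and
jointly Gaussian, hence independent. -/

namespace DobricOjeda

/-! ### Binomial series and termwise differentiation. -/

/-- The coefficients of the power series of `(1 - x) ^ (-a)`. -/
noncomputable def binomCoeff (a : ℝ) (n : ℕ) : ℝ := Ring.choose (a + n - 1) n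

lemma hasSum_binomCoeff (a : ℝ) {x : ℝ} (hx : |x| < 1) :
    HasSum (fun n => binomCoeff a n * x ^ n) ((1 - x) ^ (-a)) := by
  have h := (Real.one_div_one_sub_rpow_hasFPowerSeriesOnBall_zero a).hasSum
    (y := x) (by simpa [enorm_eq_nnnorm, ← NNReal.coe_lt_one] using! hx)
  have h1 : (0:ℝ) ≤ 1 - x := by have := (abs_lt.1 hx).2; linarith
  simpa [binomCoeff, Real.rpow_neg h1, FormalMultilinearSeries.ofScalars_apply_eq, mul_comm] using h

lemma binomCoeff_zero (a : ℝ) : binomCoeff a 0 = 1 := by simp [binomCoeff]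

lemma binomCoeff_succ (a : ℝ) (n : ℕ) :
    (n + 1) * binomCoeff a (n + 1) = (a + n) * binomCoeff a n := by
  have key (m : ℕ) : (m.factorial : ℝ) * binomCoeff a m = (ascPochhammer ℝ m).eval a := by
    have := Ring.descPochhammer_eq_factorial_smul_choose (R := ℝ) (a + m - 1) m
    rw [binomCoeff, ← nsmul_eq_mul, ← this, Polynomial.descPochhammer_smeval_eq_ascPochhammer,
      Polynomial.ascPochhammer_smeval_eq_eval]
    congr 1; ring
  have h1 := key n
  have h2 := key (n + 1)
  rw [ascPochhammer_succ_right] at h2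
  simp only [Polynomial.eval_mul, Polynomial.eval_add, Polynomial.eval_X, Polynomial.eval_natCast, ← h1,
    Nat.factorial_succ] at h2
  push_cast at h2
  have h3 : (n.factorial : ℝ) ≠ 0 := by positivity
  apply mul_left_cancel₀ h3
  linear_combination h2

/-- With `|x| < ρ < σ < 1`, the terms `c n * σ ^ n` are bounded, so on `(-ρ, ρ)` the differentiated
series is dominated by a multiple of `n (ρ/σ)^n`. -/
lemma hasDerivAt_tsum_pow {c : ℕ → ℝ} (hc : ∀ x : ℝ, |x| < 1 → Summable fun n => c n * x ^ n)
    {x : ℝ} (hx : |x| < 1) :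
    HasDerivAt (fun y => ∑' n, c n * y ^ n) (∑' n, c n * (n * x ^ (n - 1))) x ∧
      Summable fun n => c n * (n * x ^ (n - 1)) := by
  obtain ⟨ρ, hxρ, hρ1⟩ := exists_between hx
  obtain ⟨σ, hρσ, hσ1⟩ := exists_between hρ1
  have hρ0 : 0 < ρ := (abs_nonneg x).trans_lt hxρ
  have hσ0 : 0 < σ := hρ0.trans hρσ
  obtain ⟨C, hC⟩ : ∃ C, ∀ n, |c n * σ ^ n| ≤ C := by
    obtain ⟨C, hC⟩ := (hc σ (by rwa [abs_of_pos hσ0])).tendsto_atTop_zero.abs.bddAbove_range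
    exact ⟨C, fun n => hC (Set.mem_range_self n)⟩
  have hq : ρ / σ < 1 := (div_lt_one hσ0).2 hρσ
  have hu : Summable fun n : ℕ => (C / ρ) * ((n : ℝ) * (ρ / σ) ^ n) := by
    have hq' : ‖ρ / σ‖ < 1 := by rwa [Real.norm_eq_abs, abs_of_pos (by positivity)]
    have := summable_pow_mul_geometric_of_norm_lt_one 1 hq'
    simp only [pow_one] at this
    exact this.mul_left _
  have hb : ∀ n : ℕ, ∀ y ∈ Set.Ioo (-ρ) ρ, ‖c n * (n * y ^ (n - 1))‖ ≤
      (C / ρ) * ((n : ℝ) * (ρ / σ) ^ n) := by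
    intro n y hy
    rcases n.eq_zero_or_pos with rfl | hn
    · simp
    have hy' : |y| ≤ ρ := (abs_lt.2 hy).le
    have h1 := hC n
    rw [abs_mul, abs_of_pos (pow_pos hσ0 n), ← le_div_iff₀ (by positivity)] at h1
    have h2 : 0 ≤ C / σ ^ n := (abs_nonneg _).trans h1
    calc ‖c n * (n * y ^ (n - 1))‖ = |c n| * (n * |y| ^ (n - 1)) := by
          simp
      _ ≤ (C / σ ^ n) * (n * ρ ^ (n - 1)) := by gcongr
      _ = _ := by
          obtain ⟨m, rfl⟩ : ∃ m, n = m + 1 := ⟨n - 1, by omega⟩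
          simp only [Nat.add_sub_cancel, div_pow]
          field_simp
          ring
  have hxm : x ∈ Set.Ioo (-ρ) ρ := abs_lt.1 hxρ
  have hd : ∀ n : ℕ, ∀ y ∈ Set.Ioo (-ρ) ρ,
      HasDerivAt (fun y => c n * y ^ n) (c n * (n * y ^ (n - 1))) y :=
    fun n y _ => (hasDerivAt_pow n y).const_mul (c n)
  exact ⟨hasDerivAt_tsum_of_isPreconnected hu isOpen_Ioo isPreconnected_Ioo hd hb hxm (hc x hx) hxm,
    .of_norm_bounded hu fun n => hb n x hxm⟩

/-! ### Beta integrals and the power series of the reduced integral. -/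

section

lemma ofReal_rpow_mul_one_sub_rpow {a b x : ℝ} (hx : x ∈ Set.Ioc (0 : ℝ) 1) :
    ((x ^ a * (1 - x) ^ b : ℝ) : ℂ) =
      (x : ℂ) ^ (((a + 1 : ℝ) : ℂ) - 1) * (1 - x) ^ (((b + 1 : ℝ) : ℂ) - 1) := by
  rw [Complex.ofReal_mul, Complex.ofReal_cpow hx.1.le,
    Complex.ofReal_cpow (sub_nonneg.2 hx.2)]
  push_cast
  simp

lemma intervalIntegrable_rpow_mul_one_sub_rpow {a b : ℝ} (ha : -1 < a) (hb : -1 < b) :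
    IntervalIntegrable (fun x : ℝ => x ^ a * (1 - x) ^ b) volume 0 1 := by
  have h := Complex.betaIntegral_convergent (u := ((a + 1 : ℝ) : ℂ)) (v := ((b + 1 : ℝ) : ℂ))
    (by rw [Complex.ofReal_re]; linarith) (by rw [Complex.ofReal_re]; linarith)
  rw [intervalIntegrable_iff_integrableOn_Ioc_of_le zero_le_one] at h ⊢
  refine h.re.congr ?_
  filter_upwards [ae_restrict_mem measurableSet_Ioc] with x hx
  rw [← ofReal_rpow_mul_one_sub_rpow hx]
  simp

lemma integral_rpow_mul_one_sub_rpow {a b : ℝ} (ha : -1 < a) (hb : -1 < b) :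
    ∫ x in (0 : ℝ)..1, x ^ a * (1 - x) ^ b = beta (a + 1) (b + 1) := by
  rw [beta_eq_betaIntegralReal _ _ (by linarith) (by linarith), Complex.betaIntegral,
    ← Complex.ofReal_re (∫ x in (0 : ℝ)..1, x ^ a * (1 - x) ^ b),
    ← intervalIntegral.integral_ofReal]
  congr 1
  refine intervalIntegral.integral_congr_ae (.of_forall fun x hx => ?_)
  rw [Set.uIoc_of_le zero_le_one] at hx
  exact ofReal_rpow_mul_one_sub_rpow hx

lemma beta_add_one_left {p q : ℝ} (hp : p ≠ 0) (hpq : p + q ≠ 0) :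
    (p + q) * beta (p + 1) q = p * beta p q := by
  rw [beta, beta, Real.Gamma_add_one hp, show p + 1 + q = p + q + 1 by ring,
    Real.Gamma_add_one hpq]
  field_simp

/-- `∫₀¹ v^α (1-v)^(-2α) (1-rv)^α dv`. -/
noncomputable def reducedIntegral (α r : ℝ) : ℝ :=
  ∫ v in (0 : ℝ)..1, v ^ α * (1 - v) ^ (-2 * α) * (1 - r * v) ^ α

/-- Obtained by expanding `(1 - r v)^α` in powers of `r v` and integrating each term as a Beta
integral. -/
noncomputable def reducedCoeff (α : ℝ) (n : ℕ) : ℝ :=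
  binomCoeff (-α) n * beta (α + n + 1) (1 - 2 * α)

variable {α : ℝ}

lemma summable_abs_binomCoeff (a : ℝ) {x : ℝ} (hx : |x| < 1) :
    Summable fun n => |binomCoeff a n * x ^ n| := by
  exact (hasSum_binomCoeff a hx).summable.abs

lemma hasSum_reducedIntegral (hα : -1 < α) (hα' : α < 1 / 2) {r : ℝ} (hr : |r| < 1) :
    HasSum (fun n => reducedCoeff α n * r ^ n) (reducedIntegral α r) := by
  have hint (n : ℕ) : IntervalIntegrable (fun v : ℝ => v ^ (α + n) * (1 - v) ^ (-2 * α))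
      volume 0 1 := intervalIntegrable_rpow_mul_one_sub_rpow
        (by have : (0:ℝ) ≤ n := n.cast_nonneg
            linarith) (by linarith)
  have key := intervalIntegral.hasSum_integral_of_dominated_convergence (μ := volume)
    (a := 0) (b := 1) (ι := ℕ)
    (F := fun n v => binomCoeff (-α) n * r ^ n * (v ^ (α + n) * (1 - v) ^ (-2 * α)))
    (f := fun v => v ^ α * (1 - v) ^ (-2 * α) * (1 - r * v) ^ α)
    (fun n v => |binomCoeff (-α) n * r ^ n| * (v ^ α * (1 - v) ^ (-2 * α)))
    (fun n => Measurable.aestronglyMeasurable (by fun_prop)) ?_ ?_ ?_ ?_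
  · convert! key using 2 with n
    rw [intervalIntegral.integral_const_mul, integral_rpow_mul_one_sub_rpow, reducedCoeff]
    · rw [show -2 * α + 1 = 1 - 2 * α by ring]; ring
    · have : (0:ℝ) ≤ n := n.cast_nonneg
      linarith
    · linarith
  · intro n
    refine .of_forall fun v hv => ?_
    rw [Set.uIoc_of_le zero_le_one] at hv
    have h1 : 0 ≤ 1 - v := by linarith [hv.2]
    have h2 : v ^ n ≤ 1 := pow_le_one₀ hv.1.le hv.2
    rw [Real.rpow_add_natCast hv.1.ne', Real.norm_eq_abs, abs_mul]
    have h3 : 0 ≤ v ^ α := Real.rpow_nonneg hv.1.le _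
    have h4 : 0 ≤ (1 - v) ^ (-2 * α) := Real.rpow_nonneg h1 _
    have h5 : 0 ≤ v ^ n := pow_nonneg hv.1.le n
    rw [abs_of_nonneg (a := v ^ α * v ^ n * _) (by positivity)]
    gcongr
    nlinarith
  · exact .of_forall fun v _ => (summable_abs_binomCoeff _ hr).mul_right _
  · have := (hint 0).const_mul (∑' n, |binomCoeff (-α) n * r ^ n|)
    simpa [tsum_mul_right] using this
  · refine .of_forall fun v hv => ?_
    rw [Set.uIoc_of_le zero_le_one] at hv
    have hrv : |r * v| < 1 := by
      rw [abs_mul, abs_of_pos hv.1]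
      nlinarith [hv.2, hv.1, abs_nonneg r]
    have := (hasSum_binomCoeff (-α) hrv).mul_left (v ^ α * (1 - v) ^ (-2 * α))
    rw [neg_neg] at this
    convert! this using 2 with n
    rw [Real.rpow_add_natCast hv.1.ne']
    ring

/-- The last factor lies between `(1-v)^α` and `1`, in an order depending on the sign of `α`; the
sum of both covers either case and is free of `r`. -/
lemma norm_reducedIntegrand_le {r v : ℝ} (hr : r ∈ Set.Icc (0 : ℝ) 1) (hv : 0 < v) (hv' : v < 1) :
    ‖v ^ α * (1 - v) ^ (-2 * α) * (1 - r * v) ^ α‖ ≤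
      v ^ α * (1 - v) ^ (-2 * α) + v ^ α * (1 - v) ^ (-α) := by
  have h1 : 0 < 1 - v := sub_pos.2 hv'
  have h2 : 1 - v ≤ 1 - r * v := by nlinarith [hr.2, hv]
  have h3 : 1 - r * v ≤ 1 := by nlinarith [hr.1, hv]
  have h4 : (1 - r * v) ^ α ≤ 1 + (1 - v) ^ α := by
    rcases le_total 0 α with h | h
    · exact (Real.rpow_le_one (h1.le.trans h2) h3 h).trans
        (le_add_of_nonneg_right (Real.rpow_nonneg h1.le _))
    · exact (Real.rpow_le_rpow_of_nonpos h1 h2 h).trans (le_add_of_nonneg_left zero_le_one)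
  have h5 : 0 ≤ v ^ α * (1 - v) ^ (-2 * α) :=
    mul_nonneg (Real.rpow_nonneg hv.le _) (Real.rpow_nonneg h1.le _)
  rw [Real.norm_eq_abs, abs_of_nonneg (mul_nonneg h5 (Real.rpow_nonneg (h1.le.trans h2) _))]
  refine (mul_le_mul_of_nonneg_left h4 h5).trans_eq ?_
  rw [show -α = -2 * α + α by ring, Real.rpow_add h1]
  ring

lemma ae_mem_uIoc_zero_one {p : ℝ → Prop} (h : ∀ v, 0 < v → v < 1 → p v) :
    ∀ᵐ v : ℝ, v ∈ Set.uIoc (0 : ℝ) 1 → p v := by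
  have hne : ∀ᵐ v : ℝ, v ≠ 1 := by simp [ae_iff]
  filter_upwards [hne] with v hv1 hv
  rw [Set.uIoc_of_le zero_le_one] at hv
  exact h v hv.1 (lt_of_le_of_ne hv.2 hv1)

lemma intervalIntegrable_reducedBound (hα : -1 < α) (hα' : α < 1 / 2) :
    IntervalIntegrable (fun v : ℝ => v ^ α * (1 - v) ^ (-2 * α) + v ^ α * (1 - v) ^ (-α))
      volume 0 1 :=
  (intervalIntegrable_rpow_mul_one_sub_rpow hα (by linarith)).add
    (intervalIntegrable_rpow_mul_one_sub_rpow hα (by linarith))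

lemma intervalIntegrable_reducedIntegrand (hα : -1 < α) (hα' : α < 1 / 2) {r : ℝ}
    (hr : r ∈ Set.Icc (0 : ℝ) 1) :
    IntervalIntegrable (fun v : ℝ => v ^ α * (1 - v) ^ (-2 * α) * (1 - r * v) ^ α) volume 0 1 := by
  refine (intervalIntegrable_reducedBound hα hα').mono_fun'
    (Measurable.aestronglyMeasurable (by fun_prop)) ?_
  rw [Filter.EventuallyLE, ae_restrict_iff' measurableSet_uIoc]
  exact ae_mem_uIoc_zero_one fun v hv hv' => norm_reducedIntegrand_le hr hv hv'

/-- The power series only controls `|r| < 1`; dominated convergence supplies continuity up to `r =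
1`, where boundary values are needed later. -/
lemma continuousOn_reducedIntegral (hα : -1 < α) (hα' : α < 1 / 2) :
    ContinuousOn (reducedIntegral α) (Set.Icc 0 1) := by
  intro r hr
  refine intervalIntegral.continuousWithinAt_of_dominated_interval
    (.of_forall fun r => Measurable.aestronglyMeasurable (by fun_prop)) ?_
    (intervalIntegrable_reducedBound hα hα') ?_
  · filter_upwards [self_mem_nhdsWithin] with r hr
    exact ae_mem_uIoc_zero_one fun v hv hv' => norm_reducedIntegrand_le hr hv hv'
  · refine ae_mem_uIoc_zero_one fun v hv hv' => ContinuousAt.continuousWithinAt ?_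
    have h2 : 0 < 1 - r * v := by nlinarith [hr.2]
    exact continuousAt_const.mul (ContinuousAt.rpow_const (by fun_prop) (.inl h2.ne'))

end

/-! ### Second derivative of the left integral and the reflection `r ↦ 1 - r`. -/

section

lemma summable_mul_add_pow {c : ℕ → ℝ} (hc : ∀ x : ℝ, |x| < 1 → Summable fun n => c n * x ^ n)
    (p : ℝ) (x : ℝ) (hx : |x| < 1) : Summable fun n => c n * (n + p) * x ^ n := by
  have h := ((hasDerivAt_tsum_pow hc hx).2.mul_left x).add ((hc x hx).mul_left p)
  refine h.congr fun n => ?_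
  rcases n with _ | n
  · simp; ring
  · simp only [Nat.add_sub_cancel, pow_succ]; ring

lemma hasDerivAt_rpow_mul_tsum_pow {c : ℕ → ℝ}
    (hc : ∀ x : ℝ, |x| < 1 → Summable fun n => c n * x ^ n) (p : ℝ) {x : ℝ}
    (hx0 : 0 < x) (hx1 : x < 1) :
    HasDerivAt (fun y => y ^ p * ∑' n, c n * y ^ n)
      (x ^ (p - 1) * ∑' n, c n * (n + p) * x ^ n) x := by
  have hx : |x| < 1 := by rwa [abs_of_pos hx0]
  obtain ⟨h1, h2⟩ := hasDerivAt_tsum_pow hc hx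
  convert! (Real.hasDerivAt_rpow_const (p := p) (.inl hx0.ne')).mul h1 using 1
  have h3 : x ^ p = x ^ (p - 1) * x := by
    rw [← Real.rpow_add_one hx0.ne']; ring_nf
  have h4 : ∑' n, c n * (n + p) * x ^ n =
      p * ∑' n, c n * x ^ n + x * ∑' n, c n * (n * x ^ (n - 1)) := by
    rw [← tsum_mul_left, ← tsum_mul_left, ← ((hc x hx).mul_left p).tsum_add (h2.mul_left x)]
    refine tsum_congr fun n => ?_
    rcases n with _ | n
    · simp; ring
    · simp only [Nat.add_sub_cancel, pow_succ]; ring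
  rw [h3, h4]
  ring

variable {α : ℝ}

lemma reducedCoeff_succ (hα : -1 < α) (hα' : α < 1 / 2) (n : ℕ) :
    (n + 1) * (n + 2 - α) * reducedCoeff α (n + 1) =
      (n - α) * (α + n + 1) * reducedCoeff α n := by
  have hn : (0 : ℝ) ≤ n := n.cast_nonneg
  have h1 := binomCoeff_succ (-α) n
  have h2 := beta_add_one_left (p := α + n + 1) (q := 1 - 2 * α) (by linarith) (by linarith)
  simp only [reducedCoeff, Nat.cast_add, Nat.cast_one]
  rw [show α + (n + 1 : ℝ) + 1 = α + n + 1 + 1 by ring]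
  rw [show α + n + 1 + (1 - 2 * α) = n + 2 - α by ring] at h2
  linear_combination (n + 2 - α) * beta (α + n + 1 + 1) (1 - 2 * α) * h1 +
    (-α + n) * binomCoeff (-α) n * h2

/-- The two linear factors come from differentiating `r^(1-α) ∑ cₙ rⁿ` twice. What remains satisfies
the recursion of the binomial coefficients of `(1-r)^(-α-1)`, so the second derivative sums in
closed form. -/
lemma reducedCoeff_mul (hα : -1 < α) (hα' : α < 1 / 2) (n : ℕ) :
    reducedCoeff α n * (n + (1 - α)) * (n + -α) =
      -α * (1 - α) * reducedCoeff α 0 * binomCoeff (α + 1) n := by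
  induction n with
  | zero => simp [binomCoeff_zero]; ring
  | succ n ih =>
    have h1 := reducedCoeff_succ hα hα' n
    have h2 := binomCoeff_succ (α + 1) n
    have hn : (n + 1 : ℝ) ≠ 0 := by positivity
    push_cast
    apply mul_left_cancel₀ hn
    linear_combination (n + 1 - α) * h1 + (α + n + 1) * ih -
      (-α * (1 - α) * reducedCoeff α 0) * h2

/-- `∫₀ʳ (u(1-u))^α (r-u)^(-2α) du`, for `r > 0`. -/
noncomputable def leftIntegral (α r : ℝ) : ℝ := r ^ (1 - α) * reducedIntegral α r

lemma exists_deriv_leftIntegral (hα : -1 < α) (hα' : α < 1 / 2) :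
    ∃ f : ℝ → ℝ, ∃ K : ℝ, ∀ r ∈ Set.Ioo (0 : ℝ) 1, HasDerivAt (leftIntegral α) (f r) r ∧
      HasDerivAt f (K * (r ^ (-α - 1) * (1 - r) ^ (-α - 1))) r := by
  have hc : ∀ x : ℝ, |x| < 1 → Summable fun n => reducedCoeff α n * x ^ n :=
    fun x hx => (hasSum_reducedIntegral hα hα' hx).summable
  refine ⟨fun r => r ^ (-α) * ∑' n, reducedCoeff α n * (n + (1 - α)) * r ^ n,
    -α * (1 - α) * reducedCoeff α 0, fun r hr => ⟨?_, ?_⟩⟩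
  · have h := hasDerivAt_rpow_mul_tsum_pow hc (1 - α) hr.1 hr.2
    rw [show 1 - α - 1 = -α by ring] at h
    refine h.congr_of_eventuallyEq ?_
    filter_upwards [isOpen_Ioo.mem_nhds hr] with y hy
    rw [leftIntegral, (hasSum_reducedIntegral hα hα'
      (by rw [abs_of_pos hy.1]; exact hy.2)).tsum_eq]
  · have h := hasDerivAt_rpow_mul_tsum_pow (summable_mul_add_pow hc (1 - α)) (-α) hr.1 hr.2
    convert! h using 1
    simp_rw [reducedCoeff_mul hα hα', mul_assoc, tsum_mul_left]
    rw [(hasSum_binomCoeff (α + 1) (by rw [abs_of_pos hr.1]; exact hr.2)).tsum_eq,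
      show -(α + 1) = -α - 1 by ring]
    ring

lemma eqOn_of_hasDerivAt_zero {f : ℝ → ℝ} {a b : ℝ} (hf : ContinuousOn f (Set.Icc a b))
    (hf' : ∀ x ∈ Set.Ioo a b, HasDerivAt f 0 x) {x : ℝ} (hx : x ∈ Set.Icc a b) : f x = f a := by
  rcases hx.1.eq_or_lt with rfl | hax
  · rfl
  obtain ⟨c, hc, h⟩ := exists_hasDerivAt_eq_slope f (fun _ => 0) hax
    (hf.mono (Set.Icc_subset_Icc_right hx.2)) (fun y hy => hf' y ⟨hy.1, hy.2.trans_le hx.2⟩)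
  rw [eq_comm, div_eq_zero_iff] at h
  rcases h with h | h <;> linarith

lemma leftIntegral_zero (hα' : α < 1 / 2) : leftIntegral α 0 = 0 := by
  rw [leftIntegral, Real.zero_rpow (by linarith), zero_mul]

lemma leftIntegral_one (hα : -1 < α) (hα' : α < 1 / 2) :
    leftIntegral α 1 = Real.Gamma (1 + α) * Real.Gamma (1 - α) := by
  rw [leftIntegral, Real.one_rpow, one_mul, reducedIntegral]
  have : ∀ᵐ v : ℝ, v ∈ Set.uIoc (0 : ℝ) 1 → v ^ α * (1 - v) ^ (-2 * α) * (1 - 1 * v) ^ α =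
      v ^ α * (1 - v) ^ (-α) := by
    refine ae_mem_uIoc_zero_one fun v hv hv' => ?_
    rw [one_mul, mul_assoc, ← Real.rpow_add (sub_pos.2 hv')]
    ring_nf
  rw [intervalIntegral.integral_congr_ae this, integral_rpow_mul_one_sub_rpow hα (by linarith),
    beta, show α + 1 + (-α + 1) = 2 by ring, Real.Gamma_two, div_one]
  ring_nf

lemma continuousOn_leftIntegral (hα : -1 < α) (hα' : α < 1 / 2) :
    ContinuousOn (leftIntegral α) (Set.Icc 0 1) :=
  (Real.continuous_rpow_const (by linarith)).continuousOn.mul (continuousOn_reducedIntegral hα hα')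

/-- The second derivative is symmetric under reflection, so the left side is affine in `r`. Its
values at `0` and `1` are `± leftIntegral α 1`, a Beta integral. -/
lemma leftIntegral_sub (hα : -1 < α) (hα' : α < 1 / 2) {r : ℝ} (hr : r ∈ Set.Icc (0 : ℝ) 1) :
    leftIntegral α (1 - r) - leftIntegral α r =
      Real.Gamma (1 + α) * Real.Gamma (1 - α) * (1 - 2 * r) := by
  obtain ⟨f, K, hf⟩ := exists_deriv_leftIntegral hα hα'
  have hmem {x : ℝ} (hx : x ∈ Set.Ioo (0 : ℝ) 1) : 1 - x ∈ Set.Ioo (0 : ℝ) 1 :=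
    ⟨by linarith [hx.2], by linarith [hx.1]⟩
  have hsub (x : ℝ) : HasDerivAt (fun y : ℝ => 1 - y) (-1) x := by
    simpa using (hasDerivAt_id x).const_sub 1
  -- The first derivative may blow up at the end points, so constancy is shown on the open interval
  -- by comparison with the midpoint.
  have hconst : ∀ x ∈ Set.Ioo (0 : ℝ) 1, -f (1 - x) - f x = -f (1 - 1 / 2) - f (1 / 2) := by
    intro x hx
    have hd : ∀ y ∈ Set.Ioo (0 : ℝ) 1, HasDerivAt (fun y => -f (1 - y) - f y) 0 y := by
      intro y hy
      have h1 := ((hf _ (hmem hy)).2.comp y (hsub y)).neg.sub (hf y hy).2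
      convert! h1 using 1
      rw [sub_sub_cancel]; ring
    rcases le_total x (1 / 2) with h | h
    · exact (eqOn_of_hasDerivAt_zero (f := fun y => -f (1 - y) - f y) (a := x) (b := 1 / 2)
        (fun y hy => (hd y ⟨hx.1.trans_le hy.1, hy.2.trans_lt (by norm_num)⟩).continuousAt.continuousWithinAt)
        (fun y hy => hd y ⟨hx.1.trans hy.1, hy.2.trans (by norm_num)⟩) ⟨h, le_rfl⟩).symm
    · exact eqOn_of_hasDerivAt_zero (f := fun y => -f (1 - y) - f y) (a := 1 / 2) (b := x)
        (fun y hy => (hd y ⟨lt_of_lt_of_le (by norm_num) hy.1, hy.2.trans_lt hx.2⟩).continuousAt.continuousWithinAt)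
        (fun y hy => hd y ⟨lt_trans (by norm_num) hy.1, hy.2.trans hx.2⟩) ⟨h, le_rfl⟩
  set p := -f (1 - 1 / 2) - f (1 / 2) with hp
  have hcont : ContinuousOn (fun y => leftIntegral α (1 - y) - leftIntegral α y - p * y)
      (Set.Icc 0 1) := by
    refine ((ContinuousOn.comp (continuousOn_leftIntegral hα hα') (by fun_prop) ?_).sub
      (continuousOn_leftIntegral hα hα')).sub (by fun_prop)
    exact fun y hy => ⟨by linarith [hy.2], by linarith [hy.1]⟩
  have hderiv : ∀ y ∈ Set.Ioo (0 : ℝ) 1,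
      HasDerivAt (fun y => leftIntegral α (1 - y) - leftIntegral α y - p * y) 0 y := by
    intro y hy
    have h1 := (((hf _ (hmem hy)).1.comp y (hsub y)).sub (hf y hy).1).sub
      ((hasDerivAt_id y).const_mul p)
    convert! h1 using 1
    linarith [hconst y hy]
  -- Evaluation at `1` identifies the slope: `p = -2 * leftIntegral α 1`.
  have e1 := eqOn_of_hasDerivAt_zero hcont hderiv (x := 1) ⟨zero_le_one, le_rfl⟩
  have e2 := eqOn_of_hasDerivAt_zero hcont hderiv hr
  simp only [sub_self, sub_zero, leftIntegral_zero hα', leftIntegral_one hα hα'] at e1 e2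
  linear_combination e2 - r * e1

end

/-! ### The kernel integrated against the derivative of the fractional Brownian covariance. -/

section

variable {α : ℝ}

lemma leftIntegrand_scaled {r v : ℝ} (hr : 0 < r) (hv : 0 ≤ v) (hv' : v ≤ 1) :
    (r * v) ^ α * (1 - r * v) ^ α * (r - r * v) ^ (-2 * α) =
      r ^ (-α) * (v ^ α * (1 - v) ^ (-2 * α) * (1 - r * v) ^ α) := by
  rw [show r - r * v = r * (1 - v) by ring, Real.mul_rpow hr.le hv,
    Real.mul_rpow hr.le (sub_nonneg.2 hv'), show -α = α + -2 * α by ring, Real.rpow_add hr]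
  ring

lemma intervalIntegrable_leftIntegrand (hα : -1 < α) (hα' : α < 1 / 2) {r : ℝ}
    (hr : r ∈ Set.Icc (0 : ℝ) 1) :
    IntervalIntegrable (fun u => u ^ α * (1 - u) ^ α * (r - u) ^ (-2 * α)) volume 0 r := by
  rcases hr.1.eq_or_lt with rfl | hr0
  · exact .refl
  have h : IntervalIntegrable (fun v => (r * v) ^ α * (1 - r * v) ^ α * (r - r * v) ^ (-2 * α))
      volume 0 1 := by
    refine ((intervalIntegrable_reducedIntegrand hα hα' hr).const_mul (r ^ (-α))).congr ?_
    intro v hv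
    rw [Set.uIoc_of_le zero_le_one] at hv
    exact (leftIntegrand_scaled hr0 hv.1.le hv.2).symm
  have := h.comp_mul_left (c := r⁻¹)
  simpa [hr0.ne'] using this

lemma integral_leftIntegrand (hα' : α < 1 / 2) {r : ℝ} (hr : r ∈ Set.Icc (0 : ℝ) 1) :
    ∫ u in (0 : ℝ)..r, u ^ α * (1 - u) ^ α * (r - u) ^ (-2 * α) = leftIntegral α r := by
  rcases hr.1.eq_or_lt with rfl | hr0
  · rw [intervalIntegral.integral_same, leftIntegral_zero hα']
  have h := intervalIntegral.mul_integral_comp_mul_left (a := 0) (b := 1)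
    (f := fun u => u ^ α * (1 - u) ^ α * (r - u) ^ (-2 * α)) r
  rw [mul_zero, mul_one] at h
  rw [← h, intervalIntegral.integral_congr (g := fun v => r ^ (-α) *
    (v ^ α * (1 - v) ^ (-2 * α) * (1 - r * v) ^ α)), intervalIntegral.integral_const_mul,
    leftIntegral, reducedIntegral, sub_eq_add_neg, Real.rpow_add hr0, Real.rpow_one, mul_assoc]
  intro v hv
  rw [Set.uIcc_of_le zero_le_one] at hv
  exact leftIntegrand_scaled hr0 hv.1 hv.2

/-- The kernel `u^α (1-u)^α` on `(0,1)`. -/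
noncomputable def kernel (α u : ℝ) : ℝ := u ^ α * (1 - u) ^ α

lemma kernel_one_sub (u : ℝ) : kernel α (1 - u) = kernel α u := by
  rw [kernel, kernel, sub_sub_cancel, mul_comm]

/-- The derivative of `u ↦ |u - r| ^ (1 - 2α) / (1 - 2α)`. -/
noncomputable def signedPower (α x : ℝ) : ℝ := SignType.sign x * |x| ^ (-2 * α)

lemma signedPower_neg (x : ℝ) : signedPower α (-x) = -signedPower α x := by
  simp [signedPower, Left.sign_neg]

lemma kernel_mul_signedPower_of_lt {r u : ℝ} (h : u < r) :
    kernel α u * signedPower α (u - r) = -(u ^ α * (1 - u) ^ α * (r - u) ^ (-2 * α)) := by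
  rw [signedPower, sign_neg (sub_neg.2 h), abs_of_neg (sub_neg.2 h), kernel, neg_sub]
  simp

lemma signedPower_left (hα : -1 < α) (hα' : α < 1 / 2) {r : ℝ} (hr : r ∈ Set.Icc (0 : ℝ) 1) :
    IntervalIntegrable (fun u => kernel α u * signedPower α (u - r)) volume 0 r ∧
      ∫ u in (0 : ℝ)..r, kernel α u * signedPower α (u - r) = -leftIntegral α r := by
  have hae : ∀ᵐ u : ℝ, u ∈ Set.uIoc 0 r →
      kernel α u * signedPower α (u - r) = -(u ^ α * (1 - u) ^ α * (r - u) ^ (-2 * α)) := by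
    have hne : ∀ᵐ v : ℝ, v ≠ r := by simp [ae_iff]
    filter_upwards [hne] with v hv1 hv
    rw [Set.uIoc_of_le hr.1] at hv
    exact kernel_mul_signedPower_of_lt (lt_of_le_of_ne hv.2 hv1)
  refine ⟨(intervalIntegrable_leftIntegrand hα hα' hr).neg.congr_ae ?_, ?_⟩
  · rw [Filter.EventuallyEq, ae_restrict_iff' measurableSet_uIoc]
    filter_upwards [hae] with u hu h
    exact (hu h).symm
  · rw [intervalIntegral.integral_congr_ae hae, intervalIntegral.integral_neg,
      integral_leftIntegrand hα' hr]

/-- Reflection `u ↦ 1 - u` fixes the kernel, flips the signed power and turns this into the left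
part at `1 - r`. -/
lemma signedPower_right (hα : -1 < α) (hα' : α < 1 / 2) {r : ℝ} (hr : r ∈ Set.Icc (0 : ℝ) 1) :
    IntervalIntegrable (fun u => kernel α u * signedPower α (u - r)) volume r 1 ∧
      ∫ u in r..1, kernel α u * signedPower α (u - r) = leftIntegral α (1 - r) := by
  obtain ⟨h1, h2⟩ := signedPower_left hα hα' (r := 1 - r) ⟨by linarith [hr.2], by linarith [hr.1]⟩
  have e (u : ℝ) : kernel α (1 - u) * signedPower α (1 - u - (1 - r)) =
      -(kernel α u * signedPower α (u - r)) := by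
    rw [kernel_one_sub, show 1 - u - (1 - r) = -(u - r) by ring, signedPower_neg, mul_neg]
  constructor
  · have := (h1.comp_sub_left 1).symm.neg
    rw [sub_zero, sub_sub_cancel] at this
    refine this.congr fun u _ => ?_
    rw [Pi.neg_apply, e, neg_neg]
  · have := intervalIntegral.integral_comp_sub_left (a := r) (b := 1)
      (fun u => kernel α u * signedPower α (u - (1 - r))) 1
    simp only [e, sub_self, h2, intervalIntegral.integral_neg, neg_inj] at this
    exact this

/-- `∫₀¹ u^α (1-u)^α sgn(u-r) |u-r|^(-2α) du = Γ(1+α) Γ(1-α) (1-2r)`. -/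
lemma integral_kernel_mul_signedPower (hα : -1 < α) (hα' : α < 1 / 2) {r : ℝ}
    (hr : r ∈ Set.Icc (0 : ℝ) 1) :
    IntervalIntegrable (fun u => kernel α u * signedPower α (u - r)) volume 0 1 ∧
      ∫ u in (0 : ℝ)..1, kernel α u * signedPower α (u - r) =
        Real.Gamma (1 + α) * Real.Gamma (1 - α) * (1 - 2 * r) := by
  obtain ⟨h1, h2⟩ := signedPower_left hα hα' hr
  obtain ⟨h3, h4⟩ := signedPower_right hα hα' hr
  refine ⟨h1.trans h3, ?_⟩
  rw [← intervalIntegral.integral_add_adjacent_intervals h1 h3, h2, h4, ← leftIntegral_sub hα hα' hr]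
  ring

lemma hasDerivAt_abs_sub_rpow {p r u : ℝ} (hp : p = 1 - 2 * α) (h : u ≠ r) :
    HasDerivAt (fun u => |u - r| ^ p) (p * signedPower α (u - r)) u := by
  have hsub : HasDerivAt (fun u : ℝ => u - r) 1 u := (hasDerivAt_id u).sub_const r
  have h0 : HasDerivAt (fun u => |u - r|) (SignType.sign (u - r) * 1) u :=
    HasDerivAt.comp (h₂ := fun x => |x|) u (hasDerivAt_abs (sub_ne_zero.2 h)) hsub
  have h1 := h0.rpow_const (p := p) (.inl (abs_ne_zero.2 (sub_ne_zero.2 h)))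
  convert! h1 using 1
  rw [signedPower, show p - 1 = -2 * α by rw [hp]; ring]
  ring

/-- The covariance function of fractional Brownian motion. -/
noncomputable def fbmCov (H u r : ℝ) : ℝ := (u ^ (2 * H) + r ^ (2 * H) - |u - r| ^ (2 * H)) / 2

lemma hasDerivAt_fbmCov {H r u : ℝ} (hu : 0 < u) (h : u ≠ r) :
    HasDerivAt (fun u => fbmCov H u r)
      (H * (u ^ (-2 * (1 / 2 - H)) - signedPower (1 / 2 - H) (u - r))) u := by
  have h1 := (((Real.hasDerivAt_rpow_const (p := 2 * H) (.inl hu.ne')).add_const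
    (r ^ (2 * H))).sub (hasDerivAt_abs_sub_rpow (α := 1 / 2 - H) (p := 2 * H) (by ring) h)).div_const 2
  convert! h1 using 1
  rw [show 2 * H - 1 = -2 * (1 / 2 - H) by ring]
  ring

/-- The term `u^(-2α)` contributes `B(1-α, 1+α) = Γ(1-α) Γ(1+α)`, which cancels the constant part of
`Γ(1+α) Γ(1-α) (1-2r)` and leaves a function proportional to `r`. -/
lemma integral_kernel_mul_deriv_fbmCov {H r : ℝ} (hH : 0 < H) (hH' : H < 1)
    (hr : r ∈ Set.Icc (0 : ℝ) 1) :
    IntervalIntegrable (fun u => kernel (1 / 2 - H) u *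
      (H * (u ^ (-2 * (1 / 2 - H)) - signedPower (1 / 2 - H) (u - r)))) volume 0 1 ∧
    ∫ u in (0 : ℝ)..1, kernel (1 / 2 - H) u *
      (H * (u ^ (-2 * (1 / 2 - H)) - signedPower (1 / 2 - H) (u - r))) =
        2 * H * (Real.Gamma (3 / 2 - H) * Real.Gamma (H + 1 / 2)) * r := by
  set α := 1 / 2 - H with hα
  have h1 : -1 < α := by linarith
  have h2 : α < 1 / 2 := by linarith
  obtain ⟨h3, h4⟩ := integral_kernel_mul_signedPower h1 h2 hr
  have h5 : IntervalIntegrable (fun u : ℝ => u ^ (-α) * (1 - u) ^ α) volume 0 1 :=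
    intervalIntegrable_rpow_mul_one_sub_rpow (by linarith) h1
  have h6 := integral_rpow_mul_one_sub_rpow (a := -α) (b := α) (by linarith) h1
  have e : Set.EqOn (fun u => H * (u ^ (-α) * (1 - u) ^ α - kernel α u * signedPower α (u - r)))
      (fun u => kernel α u * (H * (u ^ (-2 * α) - signedPower α (u - r)))) (Set.uIoc 0 1) := by
    intro u hu
    rw [Set.uIoc_of_le zero_le_one] at hu
    simp only
    rw [show -α = -2 * α + α by ring, Real.rpow_add hu.1, kernel]
    ring
  refine ⟨((h5.sub h3).const_mul H).congr e, ?_⟩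
  rw [← intervalIntegral.integral_congr_ae (.of_forall e), intervalIntegral.integral_const_mul,
    intervalIntegral.integral_sub h5 h3, h4, h6, beta, show -α + 1 + (α + 1) = 2 by ring,
    Real.Gamma_two, hα]
  ring_nf

end

/-! ### The Wiener integral of the kernel along a Hölder curve. -/

lemma hasDerivAt_kernel {α u : ℝ} (hu : u ∈ Set.Ioo (0 : ℝ) 1) :
    HasDerivAt (kernel α) (α * (1 - 2 * u) * kernel (α - 1) u) u := by
  have h0 : (0 : ℝ) < 1 - u := sub_pos.2 hu.2
  have h1 := (Real.hasDerivAt_rpow_const (p := α) (.inl hu.1.ne')).mul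
    (((hasDerivAt_id u).const_sub 1).rpow_const (p := α) (.inl h0.ne'))
  convert! h1 using 1
  simp only [kernel, id]
  have e1 : u ^ α = u ^ (α - 1) * u := by rw [← Real.rpow_add_one hu.1.ne']; ring_nf
  have e2 : (1 - u) ^ α = (1 - u) ^ (α - 1) * (1 - u) := by
    rw [← Real.rpow_add_one h0.ne']; ring_nf
  rw [e1, e2]
  ring

lemma kernel_nonneg {α u : ℝ} (hu : 0 ≤ u) (hu' : u ≤ 1) : 0 ≤ kernel α u :=
  mul_nonneg (Real.rpow_nonneg hu _) (Real.rpow_nonneg (sub_nonneg.2 hu') _)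

/-- The range `|α| ≤ 2` covers both exponents used later, `1/2 - H` and `-1/2 - H`. -/
lemma kernel_le {α u : ℝ} (hα : |α| ≤ 2) (hu : 0 < u) (hu' : u ≤ 1 / 2) :
    kernel α u ≤ 4 * u ^ α := by
  rw [kernel, mul_comm]
  refine mul_le_mul_of_nonneg_right ?_ (Real.rpow_nonneg hu.le _)
  calc (1 - u) ^ α ≤ (1 - u) ^ (-2 : ℝ) :=
        Real.rpow_le_rpow_of_exponent_ge (by linarith) (by linarith) (abs_le.1 hα).1
    _ ≤ (1 / 2 : ℝ) ^ (-2 : ℝ) :=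
        Real.rpow_le_rpow_of_nonpos (by norm_num) (by linarith) (by norm_num)
    _ = 4 := by
        rw [Real.rpow_neg (by norm_num)]
        norm_num

section Wiener

variable {E : Type*} [NormedAddCommGroup E]

/-- The symmetrised increment `X u + X 1 - X (1-u)`, which vanishes at `u = 0`. -/
def symmIncrement (X : ℝ → E) (u : ℝ) : E := X u + X 1 - X (1 - u)

variable {H : ℝ} {X : ℝ → E}

lemma continuousOn_of_holder (hH : 0 < H)
    (hX : ∀ u ∈ Set.Icc (0 : ℝ) 1, ∀ v ∈ Set.Icc (0 : ℝ) 1, ‖X u - X v‖ ≤ |u - v| ^ H) :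
    ContinuousOn X (Set.Icc 0 1) := by
  intro v hv
  rw [ContinuousWithinAt, tendsto_iff_norm_sub_tendsto_zero]
  refine squeeze_zero' (.of_forall fun _ => norm_nonneg _)
    (by filter_upwards [self_mem_nhdsWithin] with u hu using hX u hu v hv) ?_
  have : Continuous fun u : ℝ => |u - v| ^ H :=
    (Real.continuous_rpow_const hH.le).comp (by fun_prop)
  have h := this.tendsto v
  rw [sub_self, abs_zero, Real.zero_rpow hH.ne'] at h
  exact h.mono_left nhdsWithin_le_nhds

lemma norm_symmIncrement_le (hX0 : X 0 = 0)
    (hX : ∀ u ∈ Set.Icc (0 : ℝ) 1, ∀ v ∈ Set.Icc (0 : ℝ) 1, ‖X u - X v‖ ≤ |u - v| ^ H)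
    {u : ℝ} (hu : u ∈ Set.Icc (0 : ℝ) 1) : ‖symmIncrement X u‖ ≤ 2 * u ^ H := by
  have h1 := hX u hu 0 ⟨le_rfl, zero_le_one⟩
  have h2 := hX 1 ⟨zero_le_one, le_rfl⟩ (1 - u) ⟨by linarith [hu.2], by linarith [hu.1]⟩
  rw [hX0, sub_zero, sub_zero, abs_of_nonneg hu.1] at h1
  rw [sub_sub_cancel, abs_of_nonneg hu.1] at h2
  rw [symmIncrement, add_sub_assoc]
  linarith [norm_add_le (X u) (X 1 - X (1 - u))]

lemma continuousOn_symmIncrement (hX : ContinuousOn X (Set.Icc 0 1)) :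
    ContinuousOn (symmIncrement X) (Set.Icc 0 1) :=
  (hX.add continuousOn_const).sub
    (hX.comp (by fun_prop) fun u hu => ⟨by linarith [hu.2], by linarith [hu.1]⟩)

variable [InnerProductSpace ℝ E]

/-- `∫₀¹ u^α (1-u)^α dX(u)`, defined through integration by parts at both ends. -/
noncomputable def wienerIntegral (α : ℝ) (X : ℝ → E) : E :=
  kernel α (1 / 2) • X 1 -
    ∫ u in (0 : ℝ)..1 / 2, (α * (1 - 2 * u) * kernel (α - 1) u) • symmIncrement X u

/-- The kernel derivative is of order `u^(-1/2-H)` and the symmetrised increment of order `u^H`, so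
the product is at most `8 u^(-1/2)`. -/
lemma intervalIntegrable_symmIncrement (hH : 0 < H) (hH' : H < 1) (hX0 : X 0 = 0)
    (hX : ∀ u ∈ Set.Icc (0 : ℝ) 1, ∀ v ∈ Set.Icc (0 : ℝ) 1, ‖X u - X v‖ ≤ |u - v| ^ H) :
    IntervalIntegrable (fun u => ((1 / 2 - H) * (1 - 2 * u) * kernel (1 / 2 - H - 1) u) •
      symmIncrement X u) volume 0 (1 / 2) := by
  have hb : IntervalIntegrable (fun u : ℝ => 8 * u ^ (-(1 / 2) : ℝ)) volume 0 (1 / 2) :=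
    (intervalIntegral.intervalIntegrable_rpow' (by norm_num)).const_mul 8
  have hle : (0 : ℝ) ≤ 1 / 2 := by norm_num
  refine hb.mono_fun' ?_ ?_
  · rw [Set.uIoc_of_le hle]
    refine ContinuousOn.aestronglyMeasurable ?_ measurableSet_Ioc
    refine ContinuousOn.smul (fun u hu => ContinuousAt.continuousWithinAt ?_)
      ((continuousOn_symmIncrement (continuousOn_of_holder hH hX)).mono
        fun u hu => ⟨hu.1.le, hu.2.trans (by norm_num)⟩)
    have h1 : ContinuousAt (kernel (1 / 2 - H - 1)) u :=
      (hasDerivAt_kernel ⟨hu.1, hu.2.trans_lt (by norm_num)⟩).continuousAt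
    exact (ContinuousAt.mul (by fun_prop) (by fun_prop)).mul h1
  · rw [Filter.EventuallyLE, ae_restrict_iff' measurableSet_uIoc]
    refine .of_forall fun u hu => ?_
    rw [Set.uIoc_of_le hle] at hu
    have hu1 : u ≤ 1 := hu.2.trans (by norm_num)
    have h1 := norm_symmIncrement_le hX0 hX ⟨hu.1.le, hu1⟩
    have h2 := kernel_nonneg (α := 1 / 2 - H - 1) hu.1.le hu1
    have h3 := kernel_le (α := 1 / 2 - H - 1) (abs_le.2 ⟨by linarith, by linarith⟩) hu.1 hu.2
    have h4 : |(1 / 2 - H) * (1 - 2 * u)| ≤ 1 := by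
      rw [abs_mul]
      refine mul_le_one₀ (abs_le.2 ⟨by linarith, by linarith⟩) (abs_nonneg _)
        (abs_le.2 ⟨by linarith [hu.2], by linarith [hu.1]⟩)
    rw [norm_smul, Real.norm_eq_abs, abs_mul, abs_of_nonneg h2]
    calc |(1 / 2 - H) * (1 - 2 * u)| * kernel (1 / 2 - H - 1) u * ‖symmIncrement X u‖
        ≤ 1 * (4 * u ^ (1 / 2 - H - 1)) * (2 * u ^ H) := by
          have := Real.rpow_nonneg hu.1.le (1 / 2 - H - 1)
          gcongr
      _ = 8 * (u ^ (1 / 2 - H - 1) * u ^ H) := by ring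
      _ = _ := by rw [← Real.rpow_add hu.1]; ring_nf

/-- The scalar products of the Wiener integral of the kernel. -/
lemma inner_wienerIntegral [CompleteSpace E] (hH : 0 < H) (hH' : H < 1) (hX0 : X 0 = 0)
    (hX : ∀ u ∈ Set.Icc (0 : ℝ) 1, ∀ v ∈ Set.Icc (0 : ℝ) 1, ‖X u - X v‖ ≤ |u - v| ^ H)
    (w : E) {φ' : ℝ → ℝ} {s : Set ℝ} (hs : s.Countable)
    (hφ : ∀ u ∈ Set.Ioo (0 : ℝ) 1 \ s, HasDerivAt (fun u => inner ℝ w (X u)) (φ' u) u)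
    (hint : IntervalIntegrable (fun u => kernel (1 / 2 - H) u * φ' u) volume 0 1) :
    inner ℝ w (wienerIntegral (1 / 2 - H) X) =
      ∫ u in (0 : ℝ)..1, kernel (1 / 2 - H) u * φ' u := by
  have hle : (0 : ℝ) ≤ 1 / 2 := by norm_num
  have hI := intervalIntegrable_symmIncrement hH hH' hX0 hX
  set α := 1 / 2 - H with hα
  set ψ : ℝ → ℝ := fun u => inner ℝ w (symmIncrement X u) with hψ
  have hψs : ContinuousOn ψ (Set.Icc 0 1) := ContinuousOn.inner continuousOn_const
    (continuousOn_symmIncrement (continuousOn_of_holder hH hX))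
  have hI' : IntervalIntegrable (fun u => α * (1 - 2 * u) * kernel (α - 1) u * ψ u)
      volume 0 (1 / 2) := by
    have : IntervalIntegrable (fun u => inner ℝ w
        ((α * (1 - 2 * u) * kernel (α - 1) u) • symmIncrement X u)) volume 0 (1 / 2) :=
      ⟨hI.1.const_inner w, hI.2.const_inner w⟩
    simpa only [real_inner_smul_right] using this
  have hint1 : IntervalIntegrable (fun u => kernel α u * φ' u) volume 0 (1 / 2) :=
    hint.mono_set (by
      rw [Set.uIcc_of_le hle, Set.uIcc_of_le zero_le_one]
      exact Set.Icc_subset_Icc_right (by norm_num))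
  have hint2 : IntervalIntegrable (fun u => kernel α u * φ' u) volume (1 / 2) 1 :=
    hint.mono_set (by
      rw [Set.uIcc_of_le (by norm_num : (1 / 2 : ℝ) ≤ 1), Set.uIcc_of_le zero_le_one]
      exact Set.Icc_subset_Icc_left (by norm_num))
  have hint3 : IntervalIntegrable (fun u => kernel α u * φ' (1 - u)) volume 0 (1 / 2) := by
    have := (hint2.comp_sub_left 1).symm
    norm_num only at this
    simpa only [kernel_one_sub] using this
  have hint4 : ∫ u in (0 : ℝ)..1 / 2, kernel α u * φ' (1 - u) =
      ∫ u in (1 / 2 : ℝ)..1, kernel α u * φ' u := by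
    have := intervalIntegral.integral_comp_sub_left (a := 0) (b := 1 / 2)
      (fun u => kernel α u * φ' u) 1
    norm_num only at this
    simpa only [kernel_one_sub] using this
  -- At `0` the kernel may explode, but its product with `ψ` is at most `8 ‖w‖ u^(1/2)`; the
  -- boundary term there vanishes.
  have hcont : ContinuousOn (fun u => kernel α u * ψ u) (Set.Icc 0 (1 / 2)) := by
    intro u hu
    rcases hu.1.eq_or_lt with rfl | hu0
    · have h0 : ψ 0 = 0 := by simp [hψ, symmIncrement, hX0]
      rw [ContinuousWithinAt, h0, mul_zero, tendsto_zero_iff_norm_tendsto_zero]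
      have hlim : Filter.Tendsto (fun u : ℝ => 8 * ‖w‖ * u ^ (1 / 2 : ℝ))
          (nhdsWithin 0 (Set.Icc 0 (1 / 2))) (nhds 0) := by
        have hc : Continuous fun u : ℝ => 8 * ‖w‖ * u ^ (1 / 2 : ℝ) :=
          continuous_const.mul (Real.continuous_rpow_const (by norm_num))
        have := hc.tendsto 0
        rw [Real.zero_rpow (by norm_num), mul_zero] at this
        exact this.mono_left nhdsWithin_le_nhds
      refine squeeze_zero' (.of_forall fun _ => norm_nonneg _) ?_ hlim
      filter_upwards [self_mem_nhdsWithin] with u hu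
      rcases hu.1.eq_or_lt with rfl | hu0
      · rw [h0, mul_zero, norm_zero, Real.zero_rpow (by norm_num), mul_zero]
      have hu1 : u ≤ 1 := hu.2.trans (by norm_num)
      have h1 := norm_symmIncrement_le hX0 hX ⟨hu.1, hu1⟩
      have h2 := kernel_nonneg (α := α) hu.1 hu1
      have h3 := kernel_le (α := α) (abs_le.2 ⟨by linarith, by linarith⟩) hu0 hu.2
      have h4 : ‖ψ u‖ ≤ ‖w‖ * ‖symmIncrement X u‖ := norm_inner_le_norm w _
      have h5 := Real.rpow_nonneg hu.1 α
      rw [norm_mul, Real.norm_eq_abs, abs_of_nonneg h2]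
      calc kernel α u * ‖ψ u‖ ≤ 4 * u ^ α * (‖w‖ * (2 * u ^ H)) := by
            gcongr
            exact h4.trans (by gcongr)
        _ = 8 * ‖w‖ * (u ^ α * u ^ H) := by ring
        _ = _ := by rw [← Real.rpow_add hu0, hα, sub_add_cancel]
    · have h1 : u ∈ Set.Ioo (0 : ℝ) 1 := ⟨hu0, hu.2.trans_lt (by norm_num)⟩
      exact (hasDerivAt_kernel h1).continuousAt.continuousWithinAt.mul
        ((hψs u ⟨h1.1.le, h1.2.le⟩).mono (Set.Icc_subset_Icc_right (by norm_num)))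
  -- Integration by parts on half the interval. The kernel's symmetry folds `(1/2, 1)` onto `(0,
  -- 1/2)`, so the exceptional set must contain its reflection as well.
  have hFTC := integral_eq_of_hasDerivAt_off_countable (a := 0) (b := 1 / 2)
    (fun u => kernel α u * ψ u) (fun u => α * (1 - 2 * u) * kernel (α - 1) u * ψ u +
      (kernel α u * φ' u + kernel α u * φ' (1 - u)))
    (s := s ∪ (fun u => 1 - u) ⁻¹' s) (hs.union (hs.preimage sub_right_injective))
    (by rwa [Set.uIcc_of_le hle]) ?_ (hI'.add (hint1.add hint3))
  · rw [intervalIntegral.integral_add hI' (hint1.add hint3),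
      intervalIntegral.integral_add hint1 hint3, hint4,
      intervalIntegral.integral_add_adjacent_intervals hint1 hint2] at hFTC
    have e0 : ψ 0 = 0 := by simp [hψ, symmIncrement, hX0]
    have e1 : ψ (1 / 2) = inner ℝ w (X 1) := by
      simp only [hψ, symmIncrement]
      congr 1
      norm_num
    rw [e0, e1] at hFTC
    rw [wienerIntegral, inner_sub_right, real_inner_smul_right, ← innerSL_apply_apply ℝ w (∫ _ in _.._, _),
      ← ContinuousLinearMap.intervalIntegral_comp_comm _ hI]
    simp only [innerSL_apply_apply, real_inner_smul_right]
    simp only [hψ] at hFTC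
    linarith
  · intro u hu
    rw [min_eq_left hle, max_eq_right hle] at hu
    have h1 : u ∈ Set.Ioo (0 : ℝ) 1 := ⟨hu.1.1, hu.1.2.trans (by norm_num)⟩
    have h2 := hφ u ⟨h1, fun h => hu.2 (.inl h)⟩
    have h3 := hφ (1 - u) ⟨⟨by linarith [h1.2], by linarith [h1.1]⟩, fun h => hu.2 (.inr h)⟩
    have h4 : HasDerivAt (fun u => inner ℝ w (X (1 - u))) (φ' (1 - u) * -1) u :=
      h3.comp u (by simpa using (hasDerivAt_id u).const_sub 1)
    have h5 : HasDerivAt ψ (φ' u - φ' (1 - u) * -1) u := by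
      have := (h2.add_const (inner ℝ w (X 1))).sub h4
      refine this.congr_of_eventuallyEq (.of_forall fun v => ?_)
      simp [hψ, symmIncrement, inner_sub_right, inner_add_right]
    convert! (hasDerivAt_kernel h1).mul h5 using 1
    ring

end Wiener

/-! ### Fractional Brownian curves in a Hilbert space and the projection. -/

section FbmCurve

variable {E : Type*} [NormedAddCommGroup E] [InnerProductSpace ℝ E] {H : ℝ} {X : ℝ → E}

lemma norm_sub_of_inner_eq_fbmCov (hH : 0 < H) {u v : ℝ}
    (huu : inner ℝ (X u) (X u) = fbmCov H u u) (hvv : inner ℝ (X v) (X v) = fbmCov H v v)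
    (huv : inner ℝ (X u) (X v) = fbmCov H u v) : ‖X u - X v‖ = |u - v| ^ H := by
  have h0 : (0 : ℝ) ^ (2 * H) = 0 := Real.zero_rpow (by positivity)
  have h1 : ‖X u - X v‖ ^ 2 = (|u - v| ^ H) ^ 2 := by
    rw [norm_sub_sq_real, ← real_inner_self_eq_norm_sq, ← real_inner_self_eq_norm_sq, huu, hvv, huv,
      ← Real.rpow_mul_natCast (abs_nonneg _)]
    simp only [fbmCov, sub_self, abs_zero, h0]
    rw [show H * ((2 : ℕ) : ℝ) = 2 * H by push_cast; ring]
    ring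
  exact (pow_left_inj₀ (norm_nonneg _) (Real.rpow_nonneg (abs_nonneg _) _) two_ne_zero).1 h1

lemma curve_zero (hH : 0 < H) (h : inner ℝ (X 0) (X 0) = fbmCov H 0 0) : X 0 = 0 := by
  have h0 : (0 : ℝ) ^ (2 * H) = 0 := Real.zero_rpow (by positivity)
  rw [← inner_self_eq_zero (𝕜 := ℝ), h]
  simp [fbmCov, h0]

variable [CompleteSpace E]

/-- The covariance is differentiable in `u` on `(0, 1)` off the single point `r`, so the Wiener
integral pairs with `X r` through the kernel integral computed above. -/
lemma inner_curve_wienerIntegral (hH : 0 < H) (hH' : H < 1)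
    (hX : ∀ u ∈ Set.Icc (0 : ℝ) 1, ∀ v ∈ Set.Icc (0 : ℝ) 1,
      inner ℝ (X u) (X v) = fbmCov H u v)
    {r : ℝ} (hr : r ∈ Set.Icc (0 : ℝ) 1) :
    inner ℝ (X r) (wienerIntegral (1 / 2 - H) X) =
      2 * H * (Real.Gamma (3 / 2 - H) * Real.Gamma (H + 1 / 2)) * r := by
  obtain ⟨h1, h2⟩ := integral_kernel_mul_deriv_fbmCov hH hH' hr
  have hz : (0 : ℝ) ∈ Set.Icc (0 : ℝ) 1 := ⟨le_rfl, zero_le_one⟩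
  rw [← h2]
  refine inner_wienerIntegral hH hH' (curve_zero hH (hX 0 hz 0 hz))
    (fun u hu v hv => (norm_sub_of_inner_eq_fbmCov hH (hX u hu u hu) (hX v hv v hv)
      (hX u hu v hv)).le) _ (Set.countable_singleton r) (fun u hu => ?_) h1
  refine (hasDerivAt_fbmCov hu.1.1 hu.2).congr_of_eventuallyEq ?_
  filter_upwards [isOpen_Ioo.mem_nhds hu.1] with v hv
  rw [real_inner_comm, hX v ⟨hv.1.le, hv.2.le⟩ r hr]

lemma inner_wienerIntegral_of_linear (hH : 0 < H) (hH' : H < 1)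
    (hX : ∀ u ∈ Set.Icc (0 : ℝ) 1, ∀ v ∈ Set.Icc (0 : ℝ) 1,
      inner ℝ (X u) (X v) = fbmCov H u v)
    {w : E} {b : ℝ}
    (hw : ∀ u ∈ Set.Icc (0 : ℝ) 1, inner ℝ w (X u) = b * u) :
    inner ℝ w (wienerIntegral (1 / 2 - H) X) = b * beta (3 / 2 - H) (3 / 2 - H) := by
  have hz : (0 : ℝ) ∈ Set.Icc (0 : ℝ) 1 := ⟨le_rfl, zero_le_one⟩
  have h1 : IntervalIntegrable (kernel (1 / 2 - H)) volume 0 1 :=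
    intervalIntegrable_rpow_mul_one_sub_rpow (by linarith) (by linarith)
  have h2 : ∫ u in (0 : ℝ)..1, kernel (1 / 2 - H) u = beta (3 / 2 - H) (3 / 2 - H) := by
    have := integral_rpow_mul_one_sub_rpow (a := 1 / 2 - H) (b := 1 / 2 - H)
      (by linarith) (by linarith)
    rw [show (1 / 2 - H + 1 : ℝ) = 3 / 2 - H by ring] at this
    exact this
  rw [← h2, mul_comm, ← intervalIntegral.integral_mul_const]
  refine inner_wienerIntegral hH hH' (curve_zero hH (hX 0 hz 0 hz))
    (fun u hu v hv => (norm_sub_of_inner_eq_fbmCov hH (hX u hu u hu) (hX v hv v hv)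
      (hX u hu v hv)).le) _ (φ' := fun _ => b) Set.countable_empty (fun u hu => ?_) (h1.mul_const b)
  have h3 : HasDerivAt (fun u : ℝ => b * u) b u := by
    simpa using (hasDerivAt_id u).const_mul b
  refine h3.congr_of_eventuallyEq ?_
  filter_upwards [isOpen_Ioo.mem_nhds hu.1] with v hv using hw v ⟨hv.1.le, hv.2.le⟩

end FbmCurve

lemma fbmCov_scale {H t u v : ℝ} (ht : 0 < t) (hu : 0 ≤ u) (hv : 0 ≤ v) :
    fbmCov H (t * u) (t * v) = t ^ (2 * H) * fbmCov H u v := by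
  rw [fbmCov, fbmCov, ← mul_sub, abs_mul, abs_of_pos ht, Real.mul_rpow ht.le hu,
    Real.mul_rpow ht.le hv, Real.mul_rpow ht.le (abs_nonneg _)]
  ring

/-- The orthogonal projection of `Y` on the closed span of an fBm curve up to time `t`, when
`⟨Y, X r⟩ = a r`. -/
lemma exists_projection {E : Type*} [NormedAddCommGroup E] [InnerProductSpace ℝ E] [CompleteSpace E]
    {H : ℝ} {X : ℝ → E} (hH : 0 < H) (hH' : H < 1)
    (hX : ∀ u v : ℝ, 0 ≤ u → 0 ≤ v → inner ℝ (X u) (X v) = fbmCov H u v)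
    {a t : ℝ} (ht : 0 ≤ t) {Y : E} (hY : ∀ r ∈ Set.Icc 0 t, inner ℝ Y (X r) = a * r) :
    ∃ N ∈ (Submodule.span ℝ (X '' Set.Icc 0 t)).topologicalClosure,
      (∀ r ∈ Set.Icc 0 t, inner ℝ N (X r) = a * r) ∧
      inner ℝ Y N = a ^ 2 * Real.Gamma (3 / 2 - H) /
        (2 * H * Real.Gamma (H + 1 / 2) * Real.Gamma (3 - 2 * H)) * t ^ (2 - 2 * H) := by
  rcases ht.eq_or_lt with rfl | ht
  · refine ⟨0, zero_mem _, fun r hr => ?_, ?_⟩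
    · rw [le_antisymm hr.2 hr.1, inner_zero_left, mul_zero]
    · rw [inner_zero_right, Real.zero_rpow (by linarith), mul_zero]
  -- Self-similarity reduces the horizon `t` to `1`.
  set V : ℝ → E := fun u => t ^ (-H) • X (t * u) with hV
  have hmem {u : ℝ} (hu : u ∈ Set.Icc (0 : ℝ) 1) : t * u ∈ Set.Icc 0 t :=
    ⟨mul_nonneg ht.le hu.1, mul_le_of_le_one_right ht.le hu.2⟩
  have hVV : ∀ u ∈ Set.Icc (0 : ℝ) 1, ∀ v ∈ Set.Icc (0 : ℝ) 1,
      inner ℝ (V u) (V v) = fbmCov H u v := by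
    intro u hu v hv
    rw [hV, real_inner_smul_left, real_inner_smul_right, hX _ _ (hmem hu).1 (hmem hv).1,
      fbmCov_scale ht hu.1 hv.1, ← mul_assoc, ← mul_assoc, ← Real.rpow_add ht, ← Real.rpow_add ht,
      show -H + -H + 2 * H = 0 by ring, Real.rpow_zero, one_mul]
  have hG1 : 0 < Real.Gamma (3 / 2 - H) := Real.Gamma_pos_of_pos (by linarith)
  have hG2 : 0 < Real.Gamma (H + 1 / 2) := Real.Gamma_pos_of_pos (by linarith)
  have hG3 : 0 < Real.Gamma (3 - 2 * H) := Real.Gamma_pos_of_pos (by linarith)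
  set W := wienerIntegral (1 / 2 - H) V with hW
  -- Chosen to normalise `⟨X r, W⟩ = 2H Γ(3/2-H) Γ(H+1/2) t^(H-1) r` to `a r`.
  set c := a * t ^ (1 - H) / (2 * H * (Real.Gamma (3 / 2 - H) * Real.Gamma (H + 1 / 2))) with hc
  have hlin {w : E} {b : ℝ} (hw : ∀ r ∈ Set.Icc 0 t, inner ℝ w (X r) = b * r) :
      inner ℝ w W = b * t ^ (1 - H) * beta (3 / 2 - H) (3 / 2 - H) := by
    refine inner_wienerIntegral_of_linear hH hH' hVV fun u hu => ?_
    rw [hV, real_inner_smul_right, hw _ (hmem hu), show 1 - H = -H + 1 by ring,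
      Real.rpow_add_one ht.ne']
    ring
  refine ⟨c • W, Submodule.smul_mem _ _ ?_, fun r hr => ?_, ?_⟩
  -- Membership in the closed span by duality: a vector orthogonal to the curve has linear pairing
  -- with slope `0`, hence is orthogonal to `W`.
  · rw [← Submodule.orthogonal_orthogonal_eq_closure, Submodule.mem_orthogonal]
    intro w hw
    rw [hlin (b := 0) fun r hr => ?_, zero_mul, zero_mul]
    rw [zero_mul, real_inner_comm]
    exact (Submodule.mem_orthogonal _ _).1 hw _ (Submodule.subset_span ⟨r, hr, rfl⟩)
  · have hr' : r / t ∈ Set.Icc (0 : ℝ) 1 :=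
      ⟨div_nonneg hr.1 ht.le, (div_le_one ht).2 hr.2⟩
    have h1 := inner_curve_wienerIntegral hH hH' hVV hr'
    have hVr : V (r / t) = t ^ (-H) • X r := by
      simp only [hV, mul_div_cancel₀ r ht.ne']
    rw [hVr, ← hW, real_inner_smul_left, Real.rpow_neg ht.le] at h1
    have h2 : t ^ (1 - H) * t ^ H = t := by
      rw [← Real.rpow_add ht, sub_add_cancel, Real.rpow_one]
    have h3 : 0 < t ^ H := Real.rpow_pos_of_pos ht _
    rw [real_inner_smul_left, real_inner_comm]
    rw [inv_mul_eq_iff_eq_mul₀ h3.ne'] at h1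
    have hK : 2 * H * (Real.Gamma (3 / 2 - H) * Real.Gamma (H + 1 / 2)) ≠ 0 := by positivity
    rw [h1, hc]
    generalize 2 * H * (Real.Gamma (3 / 2 - H) * Real.Gamma (H + 1 / 2)) = K at hK ⊢
    field_simp
    linear_combination (a * r) * h2
  · have h2 : t ^ (2 - 2 * H) = t ^ (1 - H) * t ^ (1 - H) := by
      rw [← Real.rpow_add ht]; ring_nf
    rw [real_inner_smul_right, hlin hY, hc, h2, beta,
      show 3 / 2 - H + (3 / 2 - H) = 3 - 2 * H by ring]
    field_simp

/-! ### The Gaussian Hilbert space of a centered Gaussian process. -/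

section GaussianSpace

variable {Ω T : Type*} {mΩ : MeasurableSpace Ω} {P : Measure Ω}

lemma norm_exp_I_mul_sub_le (x y : ℝ) :
    ‖Complex.exp (Complex.I * x) - Complex.exp (Complex.I * y)‖ ≤ |x - y| := by
  have h : Complex.exp (Complex.I * x) - Complex.exp (Complex.I * y) =
      Complex.exp (Complex.I * y) * (Complex.exp (Complex.I * ((x - y : ℝ) : ℂ)) - 1) := by
    rw [mul_sub, ← Complex.exp_add, mul_one]
    push_cast
    ring_nf
  rw [h, norm_mul, Complex.norm_exp_I_mul_ofReal, one_mul]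
  exact Real.norm_exp_I_mul_ofReal_sub_one_le

lemma integrable_exp_I_mul [IsProbabilityMeasure P] {f : Ω → ℝ} (hf : AEStronglyMeasurable f P) :
    Integrable (fun ω => Complex.exp (Complex.I * f ω)) P := by
  refine Integrable.of_bound (C := 1) ?_ (.of_forall fun ω => (Complex.norm_exp_I_mul_ofReal _).le)
  exact Continuous.comp_aestronglyMeasurable (g := fun x : ℝ => Complex.exp (Complex.I * x))
    (by fun_prop) hf

lemma continuous_integral_exp_I_mul [IsProbabilityMeasure P] :
    Continuous fun f : Lp ℝ 2 P => ∫ ω, Complex.exp (Complex.I * f ω) ∂P := by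
  refine (LipschitzWith.of_dist_le_mul (K := 1) fun f g => ?_).continuous
  rw [NNReal.coe_one, one_mul, dist_eq_norm, dist_eq_norm, ← integral_sub
    (integrable_exp_I_mul (Lp.aestronglyMeasurable f))
    (integrable_exp_I_mul (Lp.aestronglyMeasurable g))]
  have hi : Integrable (f - g : Lp ℝ 2 P) P := (Lp.memLp (f - g)).integrable one_le_two
  calc _ ≤ ∫ ω, ‖(f - g : Lp ℝ 2 P) ω‖ ∂P := by
        refine norm_integral_le_of_norm_le hi.norm ?_
        filter_upwards [Lp.coeFn_sub f g] with ω hω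
        rw [hω]
        exact norm_exp_I_mul_sub_le _ _
    _ = (eLpNorm (f - g : Lp ℝ 2 P) 1 P).toReal := by
        rw [integral_norm_eq_lintegral_enorm hi.1, eLpNorm_one_eq_lintegral_enorm]
    _ ≤ (eLpNorm (f - g : Lp ℝ 2 P) 2 P).toReal :=
        ENNReal.toReal_mono (Lp.memLp (f - g)).eLpNorm_ne_top
          (eLpNorm_le_eLpNorm_of_exponent_le one_le_two (Lp.aestronglyMeasurable _))
    _ = ‖f - g‖ := (Lp.norm_def _).symm

lemma inner_eq_integral_mul (f g : Lp ℝ 2 P) : inner ℝ f g = ∫ ω, f ω * g ω ∂P := by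
  rw [L2.inner_def]
  exact integral_congr_ae (.of_forall fun ω => by simp [mul_comm])

lemma norm_sq_eq_integral (f : Lp ℝ 2 P) : ‖f‖ ^ 2 = ∫ ω, f ω ^ 2 ∂P := by
  rw [← real_inner_self_eq_norm_sq, inner_eq_integral_mul]
  simp_rw [sq]

/-- The elements of a Gaussian process, as elements of `L²`. -/
noncomputable def toL2 {Z : T → Ω → ℝ} (hZ : IsGaussianProcess Z P) (p : T) : Lp ℝ 2 P :=
  (hZ.hasGaussianLaw_eval p).memLp_two.toLp

lemma coeFn_toL2 {Z : T → Ω → ℝ} (hZ : IsGaussianProcess Z P) (p : T) : toL2 hZ p =ᵐ[P] Z p :=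
  MemLp.coeFn_toLp _

/-- The Gaussian Hilbert space generated by a Gaussian process. -/
noncomputable def gaussianSpace {Z : T → Ω → ℝ} (hZ : IsGaussianProcess Z P) :
    Submodule ℝ (Lp ℝ 2 P) :=
  (Submodule.span ℝ (Set.range (toL2 hZ))).topologicalClosure

lemma toL2_mem {Z : T → Ω → ℝ} (hZ : IsGaussianProcess Z P) (p : T) : toL2 hZ p ∈ gaussianSpace hZ :=
  Submodule.le_topologicalClosure _ (Submodule.subset_span ⟨p, rfl⟩)

variable {Z : T → Ω → ℝ} (hZ : IsGaussianProcess Z P)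

lemma integral_exp_of_mem_span [IsProbabilityMeasure P] (h0 : ∀ p, ∫ ω, Z p ω ∂P = 0)
    {f : Lp ℝ 2 P} (hf : f ∈ Submodule.span ℝ (Set.range (toL2 hZ))) :
    ∫ ω, Complex.exp (Complex.I * f ω) ∂P = Complex.exp (-((‖f‖ ^ 2 : ℝ) : ℂ) / 2) := by
  obtain ⟨c, rfl⟩ := Finsupp.mem_span_range_iff_exists_finsupp.1 hf
  set f := c.sum fun p a => a • toL2 hZ p with hf'
  set g : Ω → ℝ := fun ω => ∑ p ∈ c.support, c p • Z p ω with hg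
  have hfg : f =ᵐ[P] g := by
    rw [hf', Finsupp.sum]
    refine (Lp.coeFn_finsetSum _ _).trans ?_
    have : ∀ᵐ ω ∂P, ∀ p ∈ c.support, (c p • toL2 hZ p : Lp ℝ 2 P) ω = c p • Z p ω := by
      rw [Finset.eventually_all]
      intro p _
      filter_upwards [Lp.coeFn_smul (c p) (toL2 hZ p), coeFn_toL2 hZ p] with ω h1 h2
      rw [h1, Pi.smul_apply, h2]
    filter_upwards [this] with ω hω
    rw [Finset.sum_apply, hg]
    exact Finset.sum_congr rfl hω
  have hG : HasGaussianLaw g P := (hZ.smul (fun p => c p)).hasGaussianLaw_fun_sum (I := c.support)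
  have hg0 : ∫ ω, g ω ∂P = 0 := by
    have := integral_finsetSum (μ := P) c.support (f := fun p ω => c p • Z p ω)
      fun p _ => (hZ.hasGaussianLaw_eval p).integrable.smul (c p)
    rw [hg, this]
    refine Finset.sum_eq_zero fun p _ => ?_
    rw [integral_smul, h0, smul_zero]
  have hvar : Var[g; P] = ‖f‖ ^ 2 := by
    rw [variance_of_integral_eq_zero hG.aemeasurable hg0, norm_sq_eq_integral]
    exact integral_congr_ae (hfg.mono fun ω h => by simp only [h])
  have h1 := hG.charFun_map_eq (1 : ℝ)
  rw [charFun_apply_real, integral_map hG.aemeasurable (by fun_prop)] at h1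
  simp only [RCLike.inner_apply, conj_trivial, mul_one, hg0, hvar, Complex.ofReal_one, one_mul,
    Complex.ofReal_zero, zero_mul, zero_sub, ← neg_div] at h1
  rw [← h1]
  refine integral_congr_ae (hfg.mono fun ω h => ?_)
  simp only [h, mul_comm]

/-- Both sides are continuous in `L²`, so the identity passes from the span to its closure. -/
lemma integral_exp_of_mem_gaussianSpace [IsProbabilityMeasure P] (h0 : ∀ p, ∫ ω, Z p ω ∂P = 0)
    {f : Lp ℝ 2 P} (hf : f ∈ gaussianSpace hZ) :
    ∫ ω, Complex.exp (Complex.I * f ω) ∂P = Complex.exp (-((‖f‖ ^ 2 : ℝ) : ℂ) / 2) := by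
  have hcl : IsClosed {f : Lp ℝ 2 P | ∫ ω, Complex.exp (Complex.I * f ω) ∂P =
      Complex.exp (-((‖f‖ ^ 2 : ℝ) : ℂ) / 2)} :=
    isClosed_eq continuous_integral_exp_I_mul (by fun_prop)
  have hsub : (Submodule.span ℝ (Set.range (toL2 hZ)) : Set (Lp ℝ 2 P)) ⊆ _ :=
    fun f hf => integral_exp_of_mem_span hZ h0 hf
  exact closure_minimal hsub hcl hf

lemma map_eq_gaussianReal_of_mem_gaussianSpace [IsProbabilityMeasure P]
    (h0 : ∀ p, ∫ ω, Z p ω ∂P = 0) {f : Lp ℝ 2 P} (hf : f ∈ gaussianSpace hZ) :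
    P.map f = gaussianReal 0 (‖f‖₊ ^ 2) := by
  have hm : AEMeasurable f P := (Lp.aestronglyMeasurable f).aemeasurable
  have := Measure.isProbabilityMeasure_map hm
  refine Measure.ext_of_charFun (funext fun t => ?_)
  -- The space is linear, so the identity for `t • f` gives the characteristic function of `f` at
  -- every `t`.
  have h1 := integral_exp_of_mem_gaussianSpace hZ h0 (Submodule.smul_mem _ t hf)
  rw [charFun_gaussianReal, charFun_apply_real, integral_map hm (by fun_prop)]
  convert h1 using 1
  · refine integral_congr_ae ?_
    filter_upwards [Lp.coeFn_smul t f] with ω hω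
    rw [hω, Pi.smul_apply, smul_eq_mul]
    push_cast
    ring_nf
  · rw [norm_smul, mul_pow, Real.norm_eq_abs, sq_abs]
    push_cast
    ring_nf

lemma integral_eq_zero_of_mem_gaussianSpace [IsProbabilityMeasure P]
    (h0 : ∀ p, ∫ ω, Z p ω ∂P = 0) {f : Lp ℝ 2 P} (hf : f ∈ gaussianSpace hZ) :
    ∫ ω, f ω ∂P = 0 := by
  have h := map_eq_gaussianReal_of_mem_gaussianSpace hZ h0 hf
  have hm : AEMeasurable f P := (Lp.aestronglyMeasurable f).aemeasurable
  have h1 := integral_map hm (f := fun x : ℝ => x) (by fun_prop)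
  rw [← h1, h, integral_id_gaussianReal]

/-- Every family in the Gaussian Hilbert space is jointly Gaussian. -/
lemma isGaussianProcess_of_mem_gaussianSpace [IsProbabilityMeasure P]
    (h0 : ∀ p, ∫ ω, Z p ω ∂P = 0) {ι : Type*} {f : ι → Lp ℝ 2 P}
    (hf : ∀ i, f i ∈ gaussianSpace hZ) : IsGaussianProcess (fun i ω => f i ω) P := by
  classical
  refine ⟨fun I => ⟨isGaussian_of_map_eq_gaussianReal fun L => ?_⟩⟩
  -- Any linear functional of finitely many members is again a member, hence a real Gaussian; this
  -- is what joint Gaussianity asks.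
  set g : Lp ℝ 2 P := ∑ i : I, L (Pi.single i 1) • f i with hg
  refine ⟨0, ‖g‖₊ ^ 2, ?_⟩
  have hgm : g ∈ gaussianSpace hZ :=
    Submodule.sum_mem _ fun i _ => Submodule.smul_mem _ _ (hf i)
  have hm : AEMeasurable (fun ω => I.restrict fun i => f i ω) P :=
    aemeasurable_pi_lambda _ fun i => (Lp.aestronglyMeasurable (f i)).aemeasurable
  rw [← map_eq_gaussianReal_of_mem_gaussianSpace hZ h0 hgm,
    AEMeasurable.map_map_of_aemeasurable (by fun_prop) hm]
  refine Measure.map_congr ?_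
  refine Filter.EventuallyEq.symm ((Lp.coeFn_finsetSum _ _).trans ?_)
  have : ∀ᵐ ω ∂P, ∀ i : I, (L (Pi.single i 1) • f i : Lp ℝ 2 P) ω = L (Pi.single i 1) • f i ω := by
    rw [ae_all_iff]
    intro i
    filter_upwards [Lp.coeFn_smul (L (Pi.single i 1)) (f i)] with ω h1
    rw [h1, Pi.smul_apply]
  filter_upwards [this] with ω hω
  rw [Finset.sum_apply, Function.comp_apply]
  have hx (x : I → ℝ) : x = ∑ i, x i • Pi.single i (1 : ℝ) := by
    ext j
    simp [Finset.sum_apply, Pi.single_apply]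
  rw [hx (I.restrict fun i => f i ω), map_sum]
  refine Finset.sum_congr rfl fun i _ => ?_
  rw [hω i, map_smul, smul_eq_mul, smul_eq_mul, mul_comm]
  rfl

end GaussianSpace

/-! ### The fractional Gaussian field and the representation of `M_H`. -/

/-- Off `H = 1/2` this is the reflection formula `Γ(-2H) Γ(2H+1) = -π / sin(2πH)`. It makes each
`Z_H` a standard fractional Brownian motion. -/
lemma fieldCoeff_self {H : ℝ} (hH : 0 < H) (hH' : H < 1) : fieldCoeff H H = 1 := by
  rw [fieldCoeff]
  split_ifs with h
  · obtain rfl : H = 1 / 2 := by linarith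
    rw [conjCoeff, show (2 * (1 / 2) + 1 : ℝ) = 2 by norm_num,
      show (3 - 2 * (1 / 2) : ℝ) = 2 by norm_num, Real.Gamma_two,
      show Real.pi * (1 / 2) = Real.pi / 2 by ring, Real.sin_pi_div_two]
    norm_num
  · have hsin : 0 < Real.sin (Real.pi * H) :=
      Real.sin_pos_of_pos_of_lt_pi (by positivity)
        (by nlinarith [Real.pi_pos])
    have hG : 0 < Real.Gamma (2 * H + 1) := Real.Gamma_pos_of_pos (by linarith)
    have hcos : Real.cos (Real.pi * H) ≠ 0 := by
      rcases lt_or_gt_of_ne (show H ≠ 1 / 2 from fun h' => h (by rw [h']; norm_num)) with h' | h'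
      · exact (Real.cos_pos_of_mem_Ioo ⟨by nlinarith [Real.pi_pos], by nlinarith [Real.pi_pos]⟩).ne'
      · exact (Real.cos_neg_of_pi_div_two_lt_of_lt (by nlinarith [Real.pi_pos])
          (by nlinarith [Real.pi_pos])).ne
    have hrefl := Real.Gamma_mul_Gamma_one_sub (-(H + H))
    rw [show 1 - -(H + H) = 2 * H + 1 by ring,
      show Real.pi * -(H + H) = -(2 * (Real.pi * H)) by ring, Real.sin_neg, Real.sin_two_mul] at hrefl
    have hsq := Real.mul_self_sqrt (mul_pos hG hsin).le
    rw [sub_self, zero_mul, Real.cos_zero, show (H + H) * (Real.pi / 2) = Real.pi * H by ring]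
    have hpi := Real.pi_ne_zero
    have hmul : -(2 / Real.pi) * Real.sqrt (Real.Gamma (2 * H + 1) * Real.sin (Real.pi * H)) *
        Real.sqrt (Real.Gamma (2 * H + 1) * Real.sin (Real.pi * H)) * Real.Gamma (-(H + H)) * 1 *
        Real.cos (Real.pi * H) = -(2 / Real.pi) * Real.sin (Real.pi * H) *
        Real.cos (Real.pi * H) * (Real.Gamma (-(H + H)) * Real.Gamma (2 * H + 1)) := by
      linear_combination (-(2 / Real.pi) * Real.Gamma (-(H + H)) * Real.cos (Real.pi * H)) * hsq
    rw [hmul, hrefl]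
    have hs := hsin.ne'
    generalize Real.sin (Real.pi * H) = x at hs ⊢
    generalize Real.cos (Real.pi * H) = y at hcos ⊢
    field_simp

variable {Ω : Type*} [mΩ : MeasurableSpace Ω] {P : Measure Ω}
  {Z : ℝ≥0 × Set.Ioo (0 : ℝ) 1 → Ω → ℝ} (hZ : IsFractionalGaussianField Z P)
  (H : Set.Ioo (0 : ℝ) 1)

lemma inner_toL2 (t s : ℝ≥0) (H H' : Set.Ioo (0 : ℝ) 1) :
    inner ℝ (toL2 hZ.gaussian (t, H)) (toL2 hZ.gaussian (s, H')) =
      fieldCoeff H H' / 2 * (|(t : ℝ)| ^ ((H : ℝ) + H') + |(s : ℝ)| ^ ((H : ℝ) + H')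
          - |(t : ℝ) - s| ^ ((H : ℝ) + H')) := by
  rw [← hZ.covariance, inner_eq_integral_mul]
  refine integral_congr_ae ?_
  filter_upwards [coeFn_toL2 hZ.gaussian (t, H), coeFn_toL2 hZ.gaussian (s, H')] with ω h1 h2
  rw [h1, h2]

/-- The curve `u ↦ Z_H(u)` in `L²`. -/
noncomputable def fbmCurve (u : ℝ) : Lp ℝ 2 P := toL2 hZ.gaussian (u.toNNReal, H)

lemma inner_fbmCurve {u v : ℝ} (hu : 0 ≤ u) (hv : 0 ≤ v) :
    inner ℝ (fbmCurve hZ H u) (fbmCurve hZ H v) = fbmCov H u v := by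
  rw [fbmCurve, fbmCurve, inner_toL2 hZ, fieldCoeff_self H.2.1 H.2.2, Real.coe_toNNReal u hu,
    Real.coe_toNNReal v hv, abs_of_nonneg hu, abs_of_nonneg hv, fbmCov, two_mul]
  ring

lemma inner_conj_fbmCurve {t : ℝ≥0} {r : ℝ} (hr : r ∈ Set.Icc 0 (t : ℝ)) :
    inner ℝ (toL2 hZ.gaussian (t, conjIndex H)) (fbmCurve hZ H r) = conjCoeff H * r := by
  have h1 : (H : ℝ) + (conjIndex H : ℝ) = 1 := by
    change (H : ℝ) + (1 - H) = 1
    ring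
  rw [real_inner_comm, fbmCurve, inner_toL2 hZ, fieldCoeff, if_pos h1, h1, Real.coe_toNNReal r hr.1,
    abs_of_nonneg hr.1, abs_of_nonneg (NNReal.coe_nonneg t), abs_of_nonpos (sub_nonpos.2 hr.2)]
  simp only [Real.rpow_one]
  ring

/-- The linear span of `Z_H(r)`, `r ≤ t`, in `L²`. -/
noncomputable def pastSpan (t : ℝ≥0) : Submodule ℝ (Lp ℝ 2 P) :=
  Submodule.span ℝ (fbmCurve hZ H '' Set.Icc 0 (t : ℝ))

lemma toL2_mem_pastSpan {r t : ℝ≥0} (hr : r ≤ t) : toL2 hZ.gaussian (r, H) ∈ pastSpan hZ H t :=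
  Submodule.subset_span ⟨r, ⟨r.2, hr⟩, by rw [fbmCurve, Real.toNNReal_coe]⟩

lemma closure_pastSpan_le (t : ℝ≥0) :
    (pastSpan hZ H t).topologicalClosure ≤ gaussianSpace hZ.gaussian := by
  refine Submodule.topologicalClosure_mono (Submodule.span_mono ?_)
  rintro _ ⟨u, _, rfl⟩
  exact ⟨_, rfl⟩

lemma aestronglyMeasurable_of_mem_closure {t : ℝ≥0} {N : Lp ℝ 2 P}
    (hN : N ∈ (pastSpan hZ H t).topologicalClosure) :
    AEStronglyMeasurable[history Z hZ.measurable H t] N P := by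
  have hle : (pastSpan hZ H t).topologicalClosure ≤
      lpMeas ℝ ℝ (history Z hZ.measurable H t) 2 P := by
    refine Submodule.topologicalClosure_minimal _ (Submodule.span_le.2 ?_)
      (isClosed_aestronglyMeasurable ((history Z hZ.measurable H).le t))
    rintro _ ⟨u, hu, rfl⟩
    refine mem_lpMeas_iff_aestronglyMeasurable.2 ?_
    have hut : u.toNNReal ≤ t := Real.toNNReal_le_iff_le_coe.2 hu.2
    have h1 : StronglyMeasurable[history Z hZ.measurable H t] (Z (u.toNNReal, H)) :=
      (Filtration.stronglyAdapted_natural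
        (fun t => (hZ.measurable (t, H)).stronglyMeasurable) u.toNNReal).mono
        ((history Z hZ.measurable H).mono hut)
    exact h1.aestronglyMeasurable.congr (coeFn_toL2 hZ.gaussian _).symm
  exact mem_lpMeas_iff_aestronglyMeasurable.1 (hle hN)

lemma mem_orthogonal_pastSpan {t : ℝ≥0} {D : Lp ℝ 2 P}
    (h : ∀ r ∈ Set.Icc 0 (t : ℝ), inner ℝ D (fbmCurve hZ H r) = 0) : D ∈ (pastSpan hZ H t)ᗮ := by
  rw [pastSpan, Submodule.mem_orthogonal]
  intro w hw
  induction hw using Submodule.span_induction with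
  | mem w hw =>
    obtain ⟨r, hr, rfl⟩ := hw
    rw [real_inner_comm, h r hr]
  | zero => exact inner_zero_left _
  | add x y _ _ hx hy => rw [inner_add_left, hx, hy, add_zero]
  | smul c x _ hx => rw [real_inner_smul_left, hx, mul_zero]

/-- `N` and `M` have the same pairings with the past up to `s`, so `M` is the projection of `N` onto
its closed span. -/
lemma inner_of_le {s t : ℝ≥0} (hst : s ≤ t) {M N : Lp ℝ 2 P}
    (hM : M ∈ (pastSpan hZ H s).topologicalClosure)
    (hMr : ∀ r ∈ Set.Icc 0 (s : ℝ), inner ℝ M (fbmCurve hZ H r) = conjCoeff H * r)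
    (hNr : ∀ r ∈ Set.Icc 0 (t : ℝ), inner ℝ N (fbmCurve hZ H r) = conjCoeff H * r) :
    inner ℝ N M = inner ℝ M M := by
  have horth : N - M ∈ (pastSpan hZ H s)ᗮ := mem_orthogonal_pastSpan hZ H fun r hr => by
    rw [inner_sub_left, hMr r hr, hNr r ⟨hr.1, hr.2.trans hst⟩, sub_self]
  rw [← Submodule.orthogonal_orthogonal_eq_closure] at hM
  have := (Submodule.mem_orthogonal _ _).1 hM _ horth
  rwa [inner_sub_left, sub_eq_zero] at this

variable [IsProbabilityMeasure P]

/-- A member of the Gaussian space that is orthogonal to the past of `Z_H` has vanishing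
conditional expectation. -/
lemma condExp_eq_zero_of_orthogonal {t : ℝ≥0} {D : Lp ℝ 2 P} (hD : D ∈ gaussianSpace hZ.gaussian)
    (horth : D ∈ (pastSpan hZ H t)ᗮ) : P[D | history Z hZ.measurable H t] =ᵐ[P] 0 := by
  set X : Set.Iic t → Ω → ℝ := fun r => Z (r, H) with hX
  have hG : IsGaussianProcess (Sum.elim X fun _ : Unit => (D : Ω → ℝ)) P := by
    have h1 := isGaussianProcess_of_mem_gaussianSpace hZ.gaussian hZ.centered
      (f := Sum.elim (fun r : Set.Iic t => toL2 hZ.gaussian (r, H)) fun _ : Unit => D)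
      (by
        rintro (r | _)
        · exact toL2_mem _ _
        · exact hD)
    refine h1.congr ?_
    rintro (r | _)
    · exact coeFn_toL2 hZ.gaussian _
    · exact Filter.EventuallyEq.rfl
  -- Joint Gaussianity upgrades zero correlation with each `Z_H(r)`, `r ≤ t`, to independence from
  -- the whole past; the conditional expectation is then the mean, `0`.
  have hind := hG.indepFun_of_covariance_eq_zero (fun r => (hZ.measurable _).aemeasurable)
    (fun _ => (Lp.aestronglyMeasurable D).aemeasurable) (fun r _ => by
      rw [covariance_eq_sub (hZ.gaussian.hasGaussianLaw_eval _).memLp_two (Lp.memLp D),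
        hZ.centered, zero_mul, sub_zero]
      have h2 := (Submodule.mem_orthogonal _ _).1 horth _ (toL2_mem_pastSpan hZ H r.2)
      rw [inner_eq_integral_mul] at h2
      refine Eq.trans (integral_congr_ae ?_) h2
      filter_upwards [coeFn_toL2 hZ.gaussian (r, H)] with ω h3
      rw [h3, Pi.mul_apply])
  have hind' : IndepFun (D : Ω → ℝ) (fun ω r => X r ω) P :=
    (hind.comp measurable_id (measurable_pi_apply ())).symm
  have hcomap : history Z hZ.measurable H t = MeasurableSpace.comap (fun ω r => X r ω) inferInstance :=
    Filtration.natural_eq_comap _ _ _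
  have hm : StronglyMeasurable[MeasurableSpace.comap (D : Ω → ℝ) inferInstance] (D : Ω → ℝ) :=
    (comap_measurable _).stronglyMeasurable
  have hcond := condExp_indep_eq (μ := P) (Lp.stronglyMeasurable D).measurable.comap_le
    ((history Z hZ.measurable H).le t) hm (by rw [hcomap]; exact hind')
  rw [integral_eq_zero_of_mem_gaussianSpace hZ.gaussian hZ.centered hD] at hcond
  exact hcond

/-- The `L²` representative of `M_H(t)`. -/
lemma exists_repr_processM (t : ℝ≥0) : ∃ N ∈ (pastSpan hZ H t).topologicalClosure,
    processM Z hZ.measurable P H t =ᵐ[P] N ∧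
    (∀ r ∈ Set.Icc 0 (t : ℝ), inner ℝ N (fbmCurve hZ H r) = conjCoeff H * r) ∧
    inner ℝ N N = constM H * (t : ℝ) ^ (2 - 2 * (H : ℝ)) := by
  obtain ⟨N, hN, hNr, hNY⟩ := exists_projection (X := fbmCurve hZ H) H.2.1 H.2.2
    (fun u v hu hv => inner_fbmCurve hZ H hu hv) t.2
    (fun r hr => inner_conj_fbmCurve hZ H hr)
  set Y := toL2 hZ.gaussian (t, conjIndex H) with hY
  have horth : Y - N ∈ (pastSpan hZ H t)ᗮ := mem_orthogonal_pastSpan hZ H fun r hr => by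
    rw [inner_sub_left, inner_conj_fbmCurve hZ H hr, hNr r hr, sub_self]
  refine ⟨N, hN, ?_, hNr, ?_⟩
  · have hNG := closure_pastSpan_le hZ H t hN
    have h1 := condExp_eq_zero_of_orthogonal hZ H
      (Submodule.sub_mem _ (toL2_mem hZ.gaussian _) hNG) horth
    have hNi : Integrable N P := (Lp.memLp N).integrable one_le_two
    have hDi : Integrable (Y - N : Lp ℝ 2 P) P := (Lp.memLp _).integrable one_le_two
    have h2 : P[N | history Z hZ.measurable H t] =ᵐ[P] N :=
      condExp_of_aestronglyMeasurable' ((history Z hZ.measurable H).le t)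
        (aestronglyMeasurable_of_mem_closure hZ H hN) hNi
    have h3 : Z (t, conjIndex H) =ᵐ[P] (Y - N : Lp ℝ 2 P) + (N : Ω → ℝ) := by
      filter_upwards [coeFn_toL2 hZ.gaussian (t, conjIndex H), Lp.coeFn_sub Y N] with ω h4 h5
      rw [Pi.add_apply, h5, Pi.sub_apply, sub_add_cancel, ← h4]
    filter_upwards [condExp_congr_ae (m := history Z hZ.measurable H t) h3,
      condExp_add hDi hNi (history Z hZ.measurable H t), h1, h2] with ω e1 e2 e3 e4
    rw [processM, e1, e2, Pi.add_apply, e3, e4, Pi.zero_apply, zero_add]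
  · have h1 : inner ℝ N (Y - N) = 0 := by
      have : N ∈ (pastSpan hZ H t)ᗮᗮ := by
        rw [Submodule.orthogonal_orthogonal_eq_closure]; exact hN
      rw [real_inner_comm]
      exact (Submodule.mem_orthogonal _ _).1 this _ horth
    rw [inner_sub_right, sub_eq_zero, real_inner_comm] at h1
    rw [← h1, hNY]
    rfl

/-! ### Martingale property, covariance and independent increments. -/

/-- `Z_{1-H}(t)` and `Z_{1-H}(s)` have the same covariances `a_H r` with `Z_H(r)` for `r ≤ s ≤ t`,
so their difference conditions to zero on `ℱ_s^H`; the tower property concludes. -/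
theorem martingale_processM :
    Martingale (processM Z hZ.measurable P H) (history Z hZ.measurable H) P := by
  refine ⟨fun t => stronglyMeasurable_condExp, fun s t hst => ?_⟩
  set Yt := toL2 hZ.gaussian (t, conjIndex H) with hYt
  set Ys := toL2 hZ.gaussian (s, conjIndex H) with hYs
  have horth : Yt - Ys ∈ (pastSpan hZ H s)ᗮ := mem_orthogonal_pastSpan hZ H fun r hr => by
    rw [inner_sub_left, inner_conj_fbmCurve hZ H hr,
      inner_conj_fbmCurve hZ H ⟨hr.1, hr.2.trans hst⟩, sub_self]
  have h1 := condExp_eq_zero_of_orthogonal hZ H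
    (Submodule.sub_mem _ (toL2_mem hZ.gaussian _) (toL2_mem hZ.gaussian _)) horth
  have hDi : Integrable (Yt - Ys : Lp ℝ 2 P) P := (Lp.memLp _).integrable one_le_two
  have hi : Integrable (Z (s, conjIndex H)) P := (hZ.gaussian.hasGaussianLaw_eval _).integrable
  have h3 : Z (t, conjIndex H) =ᵐ[P] (Yt - Ys : Lp ℝ 2 P) + Z (s, conjIndex H) := by
    filter_upwards [coeFn_toL2 hZ.gaussian (t, conjIndex H),
      coeFn_toL2 hZ.gaussian (s, conjIndex H), Lp.coeFn_sub Yt Ys] with ω h4 h5 h6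
    rw [Pi.add_apply, h6, Pi.sub_apply, h4, h5, sub_add_cancel]
  have h4 := condExp_condExp_of_le (μ := P) (f := Z (t, conjIndex H))
    ((history Z hZ.measurable H).mono hst) ((history Z hZ.measurable H).le t)
  refine h4.trans ?_
  filter_upwards [condExp_congr_ae (m := history Z hZ.measurable H s) h3,
    condExp_add hDi hi (history Z hZ.measurable H s), h1] with ω e1 e2 e3
  rw [e1, e2, Pi.add_apply, e3, Pi.zero_apply, zero_add, processM]

lemma memLp_processM (t : ℝ≥0) : MemLp (processM Z hZ.measurable P H t) 2 P := by
  obtain ⟨N, _, h, _⟩ := exists_repr_processM hZ H t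
  exact (memLp_congr_ae h).2 (Lp.memLp N)

lemma integral_processM_mul (t s : ℝ≥0) :
    ∫ ω, processM Z hZ.measurable P H t ω * processM Z hZ.measurable P H s ω ∂P =
      constM H * ((min s t : ℝ≥0) : ℝ) ^ (2 - 2 * (H : ℝ)) := by
  wlog hst : s ≤ t generalizing s t
  · rw [min_comm, ← this s t (le_of_not_ge hst)]
    simp_rw [mul_comm]
  obtain ⟨N, _, hNe, hNr, _⟩ := exists_repr_processM hZ H t
  obtain ⟨M, hM, hMe, hMr, hMM⟩ := exists_repr_processM hZ H s
  rw [min_eq_left hst, ← hMM, ← inner_of_le hZ H hst hM hMr hNr, inner_eq_integral_mul]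
  refine integral_congr_ae ?_
  filter_upwards [hNe, hMe] with ω h1 h2
  rw [h1, h2]

lemma isGaussianProcess_processM : IsGaussianProcess (processM Z hZ.measurable P H) P := by
  choose N hN hNe _ using exists_repr_processM hZ H
  exact (isGaussianProcess_of_mem_gaussianSpace hZ.gaussian hZ.centered
    fun t => closure_pastSpan_le hZ H t (hN t)).congr fun t => (hNe t).symm

lemma integral_processM (t : ℝ≥0) : ∫ ω, processM Z hZ.measurable P H t ω ∂P = 0 := by
  rw [processM, integral_condExp, hZ.centered]

lemma covariance_processM (t s : ℝ≥0) :
    cov[processM Z hZ.measurable P H t, processM Z hZ.measurable P H s; P] =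
      constM H * ((min s t : ℝ≥0) : ℝ) ^ (2 - 2 * (H : ℝ)) := by
  rw [covariance_eq_sub (memLp_processM hZ H t) (memLp_processM hZ H s), integral_processM hZ,
    zero_mul, sub_zero, ← integral_processM_mul hZ H]
  rfl

theorem hasIndepIncrements_processM : HasIndepIncrements (processM Z hZ.measurable P H) P := by
  refine fun n t ht => (isGaussianProcess_processM hZ H).hasGaussianLaw_increments
    |>.iIndepFun_of_covariance_eq_zero fun i j hij => ?_
  rw [covariance_fun_sub_fun_sub (memLp_processM hZ H _) (memLp_processM hZ H _)
    (memLp_processM hZ H _) (memLp_processM hZ H _)]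
  simp_rw [covariance_processM hZ H]
  wlog h : i < j generalizing i j
  · have := this j i hij.symm (by grind)
    simp_rw [min_comm (t i.succ), min_comm (t i.castSucc)] at this
    linarith
  have h1 : i.succ ≤ j.succ := Fin.strictMono_succ h |>.le
  have h2 : i.castSucc ≤ j.succ := Fin.le_of_lt h1
  have h3 : i.castSucc ≤ j.castSucc := Fin.le_castSucc_iff.mpr h1
  -- For `i < j` each minimum is attained at the earlier increment's end point, so the four
  -- covariances cancel in pairs.
  rw [min_eq_right (ht h1), min_eq_right (ht h), min_eq_right (ht h2), min_eq_right (ht h3)]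
  ring

end DobricOjeda

theorem mainTheorem7 {Ω : Type*} [MeasurableSpace Ω] (P : Measure Ω) [IsProbabilityMeasure P]
    (Z : ℝ≥0 × Set.Ioo (0 : ℝ) 1 → Ω → ℝ)
    (hZ : DobricOjeda.IsFractionalGaussianField Z P) (H : Set.Ioo (0 : ℝ) 1) :
    Martingale (DobricOjeda.processM Z hZ.measurable P H)
        (DobricOjeda.history Z hZ.measurable H) P ∧
      HasIndepIncrements (DobricOjeda.processM Z hZ.measurable P H) P ∧
      ∀ t s : ℝ≥0,
        Integrable (fun ω => DobricOjeda.processM Z hZ.measurable P H t ω *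
          DobricOjeda.processM Z hZ.measurable P H s ω) P ∧
        ∫ ω, DobricOjeda.processM Z hZ.measurable P H t ω *
            DobricOjeda.processM Z hZ.measurable P H s ω ∂P =
          DobricOjeda.constM H * ((min s t : ℝ≥0) : ℝ) ^ (2 - 2 * (H : ℝ)) :=
  ⟨DobricOjeda.martingale_processM hZ H, DobricOjeda.hasIndepIncrements_processM hZ H,
    fun t s => ⟨(DobricOjeda.memLp_processM hZ H t).integrable_mul
      (DobricOjeda.memLp_processM hZ H s), DobricOjeda.integral_processM_mul hZ H t s⟩⟩
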